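/- \textbf{Model.} The world is in one of two states, $1$ (non-surge) or $2$ (surge), and switches between them as a continuous-time Markov chain with rates $\lambda_{1\to 2},\lambda_{2\to 1}>0$; for $\{i,j\}=\{1,2\}$ let $q_{i\to j}(s)$ be the probability that the world is in state $j$ at time $t+s$ given that it is in state $i$ at time $t$. While the world is in state $i$, an open driver receives trip requests at Poisson rate $\lambda_i>0$, whose lengths are independent with law $F_i$, an atomless probability distribution on $(0,\infty)$ with finite mean. A policy is a pair $\sigma=(\sigma_1,\sigma_2)$ of open subsets of $(0,\infty)$: the driver accepts a request of length $\tau$ received in state $i$ if and only if $\tau\in\sigma_i$; an accepted trip keeps the driver busy for time $\tau$ and pays $w_i(\tau)$, where $i$ is the state in which the trip started; after it the driver is open again, in the current state of the world. The driver starts open, in either state. Let $R(w,\sigma,t)$ be the expected total earnings from trips finished by time $t$, and let $R(w,\sigma)=\liminf_{t\to\infty}R(w,\sigma,t)/t$. A policy is optimal for $w$ if it maximizes $R(w,\cdot)$ over all policies; it is the unique optimal policy up to measure $0$ if moreover every optimal policy $\sigma'$ agrees with it $F_i$-almost everywhere in each state $i$. Let \[ R_i(w_i,\sigma_i)=\frac{\frac{1}{F_i(\sigma_i)}\int_{\sigma_i}w_i\,dF_i}{T_i(\sigma_i)},\qquad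 T_i(\sigma_i)=\frac{1}{\lambda_iF_i(\sigma_i)}+\frac{1}{F_i(\sigma_i)}\int_{\sigma_i}\tau\,dF_i(\tau) \] be the earnings rate of state $i$ (equal to $0$ if $F_i(\sigma_i)=0$). State $2$ is the surge state under $w$ if there is an open $\sigma_2\subseteq(0,\infty)$ with $R_2(w_2,\sigma_2)>R_1(w_1,\sigma_1)$ for all open $\sigma_1\subseteq(0,\infty)$. Prices $w$ meet the targets $R_1,R_2$ if $R_i(w_i,(0,\infty))=R_i$ for $i=1,2$. Put $T_i=\lambda_iF_i((0,\infty))\,T_i((0,\infty))=1+\lambda_i\int_0^\infty\tau\,dF_i(\tau)$, $\;Q_i=\lambda_{i\to j}+\lambda_i\int_0^\infty q_{i\to j}\,dF_i$, and \[ C=1-\frac{1}{T_1}\cdot\frac{Q_2(\lambda_{1\to2}T_1-Q_1)+Q_1(T_2\lambda_{1\to2}+Q_2)}{Q_2(\lambda_{1\to2}T_1-Q_1)+\lambda_{1\to2}(T_2\lambda_{1\to2}+Q_2)}. \] \textbf{Theorem.} Let $0\le R_1<R_2$ be target earnings rates. \begin{enumerate} \item There are $m_1,m_2,z_2\ge 0$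 and $z_1\in\mathbb R$ such that the prices $w_i(\tau)=m_i\tau+z_iq_{i\to j}(\tau)$ meet the targets $R_1,R_2$, state $2$ is the surge state under $w$, and, for some $t_1\in[0,\infty]$ (with $t_1>0$ if $R_1>0$), the policy $\sigma=\big((0,t_1),(0,\infty)\big)$, which accepts every surge trip and all non-surge trips of length less than $t_1$, is the unique optimal policy up to measure $0$. \item $C\in[0,1)$. \item If $R_1/R_2\in(C,1)$, there are $m_1,m_2,z_2\ge 0$ and $z_1\in\mathbb R$ such that the prices $w_i(\tau)=m_i\tau+z_iq_{i\to j}(\tau)$ meet the targets $R_1,R_2$, state $2$ is the surge state under $w$, and the policy $\big((0,\infty),(0,\infty)\big)$ that accepts every trip is the unique optimal policy up to measure $0$. \end{enumerate} -/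

import Mathlib

open MeasureTheory ProbabilityTheory Filter Set
open scoped ENNReal

noncomputable section

namespace SurgePricing

/-- Primitives of the two-state model. The index `0 : Fin 2` is the non-surge state, the index
`1 : Fin 2` is the surge state; `i.rev` is the state other than `i`. -/
structure Model where
  /-- Poisson rate of trip requests to an open driver, in each state. -/
  arrival : Fin 2 → ℝ
  arrival_pos : ∀ i, 0 < arrival i
  /-- Rate at which the world leaves state `i` for the other state. -/
  switchRate : Fin 2 → ℝ
  switchRate_pos : ∀ i, 0 < switchRate i
  /-- Distribution of the length of a requested trip, in each state. -/
  F : Fin 2 → Measure ℝ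
  F_prob : ∀ i, IsProbabilityMeasure (F i)
  F_noAtoms : ∀ i x, F i {x} = 0
  F_pos : ∀ i, F i (Iic 0) = 0
  F_mean : ∀ i, Integrable (fun τ : ℝ => τ) (F i)

namespace Model

attribute [instance] Model.F_prob

variable (M : Model)

/-- Generator (Q-matrix) of the world state, a continuous-time Markov chain on two states. -/
def generator : Matrix (Fin 2) (Fin 2) ℝ :=
  !![-M.switchRate 0, M.switchRate 0; M.switchRate 1, -M.switchRate 1]

/-- `q_{i → j}(s)`: the probability that the world is in the other state `s` time units after
being in state `i`, an entry of the transition matrix `exp (s Q)`. -/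
def switchProb (i : Fin 2) (s : ℝ) : ℝ :=
  NormedSpace.exp (s • M.generator) i i.rev

/-! ### The driver's evolution

Consider an open driver while the world is in state `i`. Two independent exponential clocks run:
the time until the next trip request, with rate `arrival i`, and the time until the world leaves
state `i`, with rate `switchRate i`.
* If the world switches first, the driver is now open in the other state.
* If a request comes first, its length `τ` has law `F i`. If `τ ∈ σ i`, it is accepted: the driver
  is busy for `τ` time units and is paid `w i τ`, and at the end of the trip the world is in the
  other state with probability `switchProb i τ`. If `τ ∉ σ i`, the driver stays open in state `i`.

After each such step the driver is open, and the future depends on the past only through the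
current world state (the residual clocks are again exponential), so the steps use independent
randomness. -/

/-- Randomness of one step: the request clock, the switching clock, the length of the requested
trip, and a uniform variable that decides the state of the world at the end of the trip. -/
abbrev Draw : Type := ℝ × ℝ × ℝ × ℝ

/-- Law of the randomness of a step that starts in state `i`. -/
def drawLaw (i : Fin 2) : Measure Draw :=
  (expMeasure (M.arrival i)).prod
    ((expMeasure (M.switchRate i)).prod ((M.F i).prod (volume.restrict (Icc (0 : ℝ) 1))))

instance (i : Fin 2) : IsProbabilityMeasure (M.drawLaw i) := by
  have := isProbabilityMeasure_expMeasure (M.arrival_pos i)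
  have := isProbabilityMeasure_expMeasure (M.switchRate_pos i)
  have : IsProbabilityMeasure (volume.restrict (Icc (0 : ℝ) 1)) := ⟨by simp⟩
  unfold drawLaw
  infer_instance

/-- Sample space: `ω (n, i)` is the randomness used by step `n` if that step starts in state `i`. -/
abbrev Path : Type := ℕ × Fin 2 → Draw

/-- All draws are independent, and `ω (n, i)` has law `drawLaw i`. -/
def pathLaw : Measure Path := Measure.infinitePi fun p : ℕ × Fin 2 => M.drawLaw p.2

instance : IsProbabilityMeasure M.pathLaw := by
  unfold pathLaw
  infer_instance

open Classical in
/-- The next state in which the driver is open. -/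
def stepState (σ : Fin 2 → Set ℝ) (i : Fin 2) : Draw → Fin 2 := fun (e, s, τ, u) =>
  if s < e then i.rev
  else if τ ∈ σ i then (if u < M.switchProb i τ then i.rev else i)
  else i

open Classical in
/-- The length of a step. -/
def stepTime (σ : Fin 2 → Set ℝ) (i : Fin 2) : Draw → ℝ := fun (e, s, τ, _) =>
  if s < e then s
  else if τ ∈ σ i then e + τ
  else e

open Classical in
/-- The earnings of a step, received when the step ends. -/
def stepPay (w : Fin 2 → ℝ → ℝ) (σ : Fin 2 → Set ℝ) (i : Fin 2) : Draw → ℝ := fun (e, s, τ, _) =>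
  if s < e then 0
  else if τ ∈ σ i then w i τ
  else 0

/-- The state of the world at the beginning of step `n`, if the driver starts open in state `i₀`. -/
def stateAt (σ : Fin 2 → Set ℝ) (i₀ : Fin 2) (ω : Path) : ℕ → Fin 2
  | 0 => i₀
  | n + 1 => M.stepState σ (stateAt σ i₀ ω n) (ω (n, stateAt σ i₀ ω n))

/-- The time at which step `n` begins. -/
def timeAt (σ : Fin 2 → Set ℝ) (i₀ : Fin 2) (ω : Path) (n : ℕ) : ℝ :=
  ∑ k ∈ Finset.range n, stepTime σ (M.stateAt σ i₀ ω k) (ω (k, M.stateAt σ i₀ ω k))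

open Classical in
/-- Total earnings from the trips that are finished by time `t`. -/
def earnings (w : Fin 2 → ℝ → ℝ) (σ : Fin 2 → Set ℝ) (i₀ : Fin 2) (t : ℝ) (ω : Path) : ℝ :=
  ∑' n : ℕ, if M.timeAt σ i₀ ω (n + 1) ≤ t
    then stepPay w σ (M.stateAt σ i₀ ω n) (ω (n, M.stateAt σ i₀ ω n)) else 0

/-- The driver's lifetime earnings rate `R(w, σ) = lim inf_{t → ∞} R(w, σ, t) / t`, where
`R(w, σ, t)` is the expectation of the earnings up to time `t`. -/
def reward (w : Fin 2 → ℝ → ℝ) (σ : Fin 2 → Set ℝ) (i₀ : Fin 2) : ℝ :=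
  liminf (fun t : ℝ => (∫ ω, M.earnings w σ i₀ t ω ∂M.pathLaw) / t) atTop

/-! ### Policies and optimality -/

/-- A policy accepts, in each state, the trips with length in an open subset of `(0, ∞)`. -/
def IsPolicy (σ : Fin 2 → Set ℝ) : Prop := ∀ i, IsOpen (σ i) ∧ σ i ⊆ Ioi 0

/-- `σ` maximizes the earnings rate. -/
def IsOptimal (w : Fin 2 → ℝ → ℝ) (i₀ : Fin 2) (σ : Fin 2 → Set ℝ) : Prop :=
  IsPolicy σ ∧ ∀ σ', IsPolicy σ' → M.reward w σ' i₀ ≤ M.reward w σ i₀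

/-- `σ` is the only optimal policy, up to differences of measure zero. -/
def IsUniqueOptimal (w : Fin 2 → ℝ → ℝ) (i₀ : Fin 2) (σ : Fin 2 → Set ℝ) : Prop :=
  M.IsOptimal w i₀ σ ∧ ∀ σ', M.IsOptimal w i₀ σ' → ∀ i, σ' i =ᵐ[M.F i] σ i

/-- All trips of length less than `t`, where `t = ∞` is allowed. -/
def upTo (t : ℝ≥0∞) : Set ℝ := {τ | 0 < τ ∧ ENNReal.ofReal τ < t}

/-! ### Earnings rates of the states -/

/-- `W_i(σ_i)`: mean earnings on the accepted trips. -/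
def meanPay (w : Fin 2 → ℝ → ℝ) (i : Fin 2) (s : Set ℝ) : ℝ :=
  1 / (M.F i).real s * ∫ τ in s, w i τ ∂M.F i

/-- `T_i(σ_i)`: expected wait for an accepted trip plus the expected length of that trip. -/
def meanTime (i : Fin 2) (s : Set ℝ) : ℝ :=
  1 / (M.arrival i * (M.F i).real s) + 1 / (M.F i).real s * ∫ τ in s, τ ∂M.F i

/-- `R_i(w_i, σ_i) = W_i(σ_i) / T_i(σ_i)`: the earnings rate of state `i`; it is `0` if no trip is
accepted. -/
def stateRate (w : Fin 2 → ℝ → ℝ) (i : Fin 2) (s : Set ℝ) : ℝ :=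
  M.meanPay w i s / M.meanTime i s

/-- Under the prices `w` the state `1` is the surge state: with some policy it has a higher
earnings rate than the other state has with any policy. -/
def IsSurge (w : Fin 2 → ℝ → ℝ) : Prop :=
  ∃ s₂ : Set ℝ, IsOpen s₂ ∧ s₂ ⊆ Ioi 0 ∧
    ∀ s₁ : Set ℝ, IsOpen s₁ → s₁ ⊆ Ioi 0 → M.stateRate w 0 s₁ < M.stateRate w 1 s₂

/-- A driver who accepts every trip earns at the target rates `R₁` and `R₂` in the two states. -/
def MeetsTargets (w : Fin 2 → ℝ → ℝ) (R₁ R₂ : ℝ) : Prop :=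
  M.stateRate w 0 (Ioi 0) = R₁ ∧ M.stateRate w 1 (Ioi 0) = R₂

/-! ### The prices and the constant -/

/-- Prices of the form `w_i(τ) = m_i τ + z_i q_{i → j}(τ)`. -/
def price (m z : Fin 2 → ℝ) : Fin 2 → ℝ → ℝ := fun i τ => m i * τ + z i * M.switchProb i τ

/-- `T_i = λ_i F_i(σ_i) T_i(σ_i)` at `σ_i = (0, ∞)`. -/
def Tfull (i : Fin 2) : ℝ := M.arrival i * (M.F i).real (Ioi 0) * M.meanTime i (Ioi 0)

/-- `Q_i = λ_{i → j} + λ_i ∫_{σ_i} q_{i → j} dF_i` at `σ_i = (0, ∞)`. -/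
def Qfull (i : Fin 2) : ℝ :=
  M.switchRate i + M.arrival i * ∫ τ in Ioi 0, M.switchProb i τ ∂M.F i

/-- The lower bound on the ratio of the target rates. -/
def ratioBound : ℝ :=
  1 - 1 / M.Tfull 0 *
    ((M.Qfull 1 * (M.switchRate 0 * M.Tfull 0 - M.Qfull 0)
        + M.Qfull 0 * (M.Tfull 1 * M.switchRate 0 + M.Qfull 1))
      / (M.Qfull 1 * (M.switchRate 0 * M.Tfull 0 - M.Qfull 0)
        + M.switchRate 0 * (M.Tfull 1 * M.switchRate 0 + M.Qfull 1)))

end Model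

end SurgePricing

end

/-!
The driver's evolution is a Markov renewal process, so a policy `σ` earns at the rate
`(Q₁ W₀ + Q₀ W₁) / (Q₁ T₀ + Q₀ T₁)`. Here `Wᵢ`, `Tᵢ` and `Qᵢ` are the mean earnings, the mean time and
the mean number of changes of state in a step from state `i`, all multiplied by the total rate of the
two clocks (`reward_price`). This follows from the renewal-reward theorem
`reward_eq_of_isPoissonSolution`: if `h` solves the Poisson equation with constant `g`, then the
earnings less `g` times the elapsed time plus the change of `h` have mean `0` in each step, and
summation over the steps that begin by time `t` gives expected earnings `g t` up to an error that
stems from the step in progress at time `t`. As durations have a finite mean, this error is `o(t)`.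

With `g` the optimal rate and `d` the advantage of being open in the surge state, a trip of length
`τ` in state `0` or `1` adds the value `wᵢ(τ) - g τ ± d qᵢ(τ)`. A policy that accepts exactly the trips
of positive value is optimal as soon as this value balances the cost of waiting in both states, and
it is the only one if the value vanishes for almost no trip (`isUniqueOptimal_of_tripGain`). For the
prices in question the value has the form `x τ + y q(τ)`. As `q` is strictly concave with `q(0) = 0`,
the trips of positive value are those below a threshold when `y > 0` (`exists_upTo`).

The target of state `0` is `R₁`, and that of state `1` is `R₂`. In the surge state `z = d` always
works: the value is then proportional to `τ` with a positive factor, and the target determines the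
multiplier. This forces `g = R₂ - d Q₁ / T₁`. State `1` is then the
surge state, as the value collected in state `0` is at most the cost of waiting, which is less than
`R₂` (`exists_price_of_gain`). What remains is to choose `d`, `x` and `y` such that state `0` meets its
target and is balanced.
* If the targets are close, `d` can be taken such that accepting all trips balances state `0`, and
  `x = 0` makes every trip worth accepting (`exists_price_of_ratio`). A ratio of the targets above the
  ratio bound suffices for this (`ratioBound_mem`).
* Otherwise the intermediate value theorem gives a solution on a segment of parameters `(d, y)` that
  ends where waiting in state `0` has no cost and the multiplier `m₀` is `0`
  (`exists_price_of_not_ratio`).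
-/

noncomputable section

/-! ### The switching probabilities -/

namespace SurgePricing
open scoped Topology
namespace Model

variable (M : Model)

/-- The total switching rate, which is the relaxation rate of the world's Markov chain. -/
def relax : ℝ := M.switchRate 0 + M.switchRate 1

lemma relax_pos : 0 < M.relax := add_pos (M.switchRate_pos 0) (M.switchRate_pos 1)

/-- The closed form of `q_{i → j}`, from the eigenbasis of the generator, whose eigenvalues are `0`
and `-relax`. -/
lemma switchProb_eq (i : Fin 2) (s : ℝ) :
    M.switchProb i s = M.switchRate i / M.relax * (1 - Real.exp (-M.relax * s)) := by
  have hΛ := M.relax_pos.ne'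
  set U : Matrix (Fin 2) (Fin 2) ℝ := !![1, M.switchRate 0; 1, -M.switchRate 1] with hU
  have hdet : U.det = -M.relax := by
    simp [hU, Matrix.det_fin_two, relax]; ring
  have hUu : IsUnit U := by
    rw [Matrix.isUnit_iff_isUnit_det, hdet]; exact (neg_ne_zero.2 hΛ).isUnit
  have hUinv : U⁻¹ = (1 / M.relax) • !![M.switchRate 1, M.switchRate 0; 1, -1] := by
    apply Matrix.inv_eq_right_inv
    ext a b
    fin_cases a <;> fin_cases b <;>
      simp [hU, Matrix.mul_apply, Fin.sum_univ_two, relax] at hΛ ⊢ <;> field_simp <;> ring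
  have hdiag (a b : ℝ) : Matrix.diagonal ![a, b] = !![a, 0; 0, b] := by
    ext j k
    fin_cases j <;> fin_cases k <;> simp
  have hgen : s • M.generator = U * Matrix.diagonal ![0, -M.relax * s] * U⁻¹ := by
    rw [hUinv, hdiag]
    ext a b
    fin_cases a <;> fin_cases b <;>
      simp [hU, generator, Matrix.mul_apply, Fin.sum_univ_two, relax] at hΛ ⊢ <;>
      field_simp <;> ring
  rw [switchProb, hgen, Matrix.exp_conj U _ hUu, Matrix.exp_diagonal, hUinv]
  have h0 : NormedSpace.exp (![0, -M.relax * s]) = ![1, Real.exp (-M.relax * s)] := by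
    ext a
    rw [Pi.coe_exp, Real.exp_eq_exp_ℝ]
    fin_cases a <;> simp
  rw [h0, hdiag]
  fin_cases i <;>
    simp [hU, Matrix.mul_apply, Fin.sum_univ_two] <;> ring

@[fun_prop]
lemma continuous_switchProb (i : Fin 2) : Continuous (M.switchProb i) := by
  have : M.switchProb i = fun s => M.switchRate i / M.relax * (1 - Real.exp (-M.relax * s)) :=
    funext (M.switchProb_eq i)
  rw [this]; fun_prop

lemma switchProb_zero (i : Fin 2) : M.switchProb i 0 = 0 := by simp [switchProb_eq]

lemma switchProb_pos (i : Fin 2) {s : ℝ} (hs : 0 < s) : 0 < M.switchProb i s := by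
  have h : Real.exp (-M.relax * s) < 1 := Real.exp_lt_one_iff.mpr (by nlinarith [M.relax_pos])
  rw [switchProb_eq]
  exact mul_pos (div_pos (M.switchRate_pos i) M.relax_pos) (by linarith)

lemma switchProb_nonneg (i : Fin 2) {s : ℝ} (hs : 0 ≤ s) : 0 ≤ M.switchProb i s := by
  rcases hs.eq_or_lt with rfl | hs
  · rw [switchProb_zero]
  · exact (M.switchProb_pos i hs).le

lemma switchProb_le_one (i : Fin 2) (s : ℝ) : M.switchProb i s ≤ 1 := by
  have h1 : M.switchRate i / M.relax ≤ 1 := by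
    rw [div_le_one M.relax_pos, relax]
    have := M.switchRate_pos 0
    have := M.switchRate_pos 1
    fin_cases i <;> simp <;> linarith
  have h0 : 0 ≤ M.switchRate i / M.relax := (div_pos (M.switchRate_pos i) M.relax_pos).le
  rw [switchProb_eq]
  nlinarith [Real.exp_pos (-M.relax * s)]

lemma switchProb_lt (i : Fin 2) {s : ℝ} (hs : 0 < s) : M.switchProb i s < M.switchRate i * s := by
  have hΛ := M.relax_pos
  have h := Real.add_one_lt_exp (x := -M.relax * s) (by nlinarith)
  have hd := div_pos (M.switchRate_pos i) hΛ
  have : M.switchRate i * s = M.switchRate i / M.relax * (M.relax * s) := by field_simp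
  rw [switchProb_eq, this]
  exact mul_lt_mul_of_pos_left (by linarith) hd

/-- `q_{i → j}` is strictly concave and vanishes at `0`, hence `q_{i → j} (τ) / τ` is strictly
decreasing. -/
lemma switchProb_ratio_strictAnti (i : Fin 2) {s t : ℝ} (hs : 0 < s) (hst : s < t) :
    s * M.switchProb i t < t * M.switchProb i s := by
  have ht := hs.trans hst
  have hΛ := M.relax_pos
  have hd := div_pos (M.switchRate_pos i) hΛ
  have h := strictConvexOn_exp.2 (mem_univ (-M.relax * t)) (mem_univ 0)
    (by have := mul_pos hΛ ht; nlinarith) (div_pos hs ht) (sub_pos.2 ((div_lt_one ht).2 hst))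
    (by ring)
  simp only [smul_eq_mul, mul_zero, add_zero, Real.exp_zero, mul_one] at h
  have e : s / t * (-M.relax * t) = -M.relax * s := by field_simp
  rw [e] at h
  have h2 := mul_lt_mul_of_pos_left h ht
  have e2 : t * (s / t * Real.exp (-M.relax * t) + (1 - s / t))
      = s * Real.exp (-M.relax * t) + t - s := by field_simp; ring
  rw [e2] at h2
  rw [switchProb_eq, switchProb_eq]
  nlinarith

lemma hasDerivAt_switchProb_zero (i : Fin 2) :
    HasDerivAt (M.switchProb i) (M.switchRate i) 0 := by
  have : M.switchProb i = fun s => M.switchRate i / M.relax * (1 - Real.exp (-M.relax * s)) :=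
    funext (M.switchProb_eq i)
  rw [this]
  have h := (((hasDerivAt_id (0 : ℝ)).const_mul (-M.relax)).exp.const_sub 1).const_mul
    (M.switchRate i / M.relax)
  convert! h using 1
  have := M.relax_pos.ne'
  simp
  field_simp

/-! ### Threshold sets -/

section Threshold

variable {M} {i : Fin 2} {x y : ℝ}

/-- Since `q_{i → j}(τ) / τ` is strictly decreasing, a gain `x τ + y q_{i → j}(τ)` that is nonnegative
at some trip length is positive at all smaller ones. -/
lemma gain_pos_of_nonneg (hy : 0 < y) {s t : ℝ} (hs : 0 < s) (hst : s < t)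
    (h : 0 ≤ x * t + y * M.switchProb i t) : 0 < x * s + y * M.switchProb i s := by
  have h1 := M.switchProb_ratio_strictAnti i hs hst
  have ht := hs.trans hst
  have h2 : 0 ≤ s * (x * t + y * M.switchProb i t) := mul_nonneg hs.le h
  have h3 : 0 < t * (x * s + y * M.switchProb i s) := by nlinarith
  exact pos_of_mul_pos_right h3 ht.le

/-- Accepting the trips with a positive gain means accepting the trips below some length. -/
lemma exists_upTo (hy : 0 < y) :
    ∃ t : ℝ≥0∞, upTo t = {τ | 0 < τ ∧ 0 < x * τ + y * M.switchProb i τ} ∧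
      (0 < x + y * M.switchRate i → 0 < t) := by
  set U : Set ℝ := {τ | 0 < τ ∧ 0 < x * τ + y * M.switchProb i τ} with hU
  have hopen : IsOpen U := by
    have hc : Continuous fun τ => x * τ + y * M.switchProb i τ := by fun_prop
    exact isOpen_Ioi.inter (isOpen_Ioi.preimage hc)
  refine ⟨⨆ τ ∈ U, ENNReal.ofReal τ, ?_, fun h => ?_⟩
  · ext τ
    constructor
    · rintro ⟨h0, h1⟩
      obtain ⟨s, hs, hlt⟩ : ∃ s ∈ U, ENNReal.ofReal τ < ENNReal.ofReal s := by
        simpa only [lt_iSup_iff, exists_prop] using h1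
      have hτs := (ENNReal.ofReal_lt_ofReal_iff hs.1).1 hlt
      exact ⟨h0, gain_pos_of_nonneg hy h0 hτs hs.2.le⟩
    · intro h
      refine ⟨h.1, ?_⟩
      have hmem : U ∈ 𝓝[>] τ := nhdsWithin_le_nhds (hopen.mem_nhds h)
      obtain ⟨s, hs, hsU⟩ := (Eventually.and hmem self_mem_nhdsWithin).exists
      exact ((ENNReal.ofReal_lt_ofReal_iff hs.1).2 hsU).trans_le
        (le_iSup₂ (f := fun s (_ : s ∈ U) => ENNReal.ofReal s) s hs)
  · have hd : HasDerivAt (fun τ => x * τ + y * M.switchProb i τ) (x * 1 + y * M.switchRate i) 0 :=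
      ((hasDerivAt_id (0 : ℝ)).const_mul x).add ((M.hasDerivAt_switchProb_zero i).const_mul y)
    have hpos : ∀ᶠ τ in 𝓝[>] (0 : ℝ), 0 < x * τ + y * M.switchProb i τ := by
      have hs := (hasDerivAt_iff_tendsto_slope.1 hd).mono_left
        (nhdsWithin_mono 0 (fun a (ha : a ∈ Ioi (0 : ℝ)) => (ne_of_gt ha : a ≠ 0)))
      filter_upwards [hs.eventually (lt_mem_nhds (by linarith : 0 < x * 1 + y * M.switchRate i)),
        self_mem_nhdsWithin] with τ h1 (h2 : 0 < τ)
      rw [slope_def_field] at h1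
      simp only [switchProb_zero, mul_zero, add_zero, sub_zero] at h1
      exact (div_pos_iff_of_pos_right h2).1 h1
    obtain ⟨τ, h1, h2⟩ := (hpos.and self_mem_nhdsWithin).exists
    have h2' : 0 < τ := h2
    exact (ENNReal.ofReal_pos.2 h2').trans_le
      (le_iSup₂ (f := fun s (_ : s ∈ U) => ENNReal.ofReal s) τ ⟨h2', h1⟩)

end Threshold

lemma ae_pos (i : Fin 2) : ∀ᵐ τ ∂M.F i, 0 < τ := by
  rw [ae_iff]; convert M.F_pos i using 2; ext; simp

instance (i : Fin 2) : NullSingletonClass (M.F i) := ⟨M.F_noAtoms i⟩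

/-- Almost no trip has zero gain. -/
lemma ae_gain_ne_zero {x y : ℝ} (i : Fin 2) (hy : 0 < y) :
    ∀ᵐ τ ∂M.F i, x * τ + y * M.switchProb i τ ≠ 0 := by
  have hsub : ({τ | 0 < τ ∧ x * τ + y * M.switchProb i τ = 0} : Set ℝ).Subsingleton := by
    rintro a ⟨ha, ha'⟩ b ⟨hb, hb'⟩
    by_contra hab
    rcases lt_or_gt_of_ne hab with h | h
    · exact (gain_pos_of_nonneg hy ha h hb'.ge).ne' ha'
    · exact (gain_pos_of_nonneg hy hb h ha'.ge).ne' hb'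
  have h0 := hsub.measure_zero (M.F i)
  filter_upwards [M.ae_pos i, (measure_eq_zero_iff_ae_notMem.1 h0)] with τ h1 h2 h3
  exact h2 ⟨h1, h3⟩

end Model

/-! ### Two exponential clocks -/

section Clocks

variable {a b : ℝ}

lemma expMeasure_Ioi (ha : 0 < a) {x : ℝ} (hx : 0 ≤ x) :
    expMeasure a (Ioi x) = ENNReal.ofReal (Real.exp (-(a * x))) := by
  have := isProbabilityMeasure_expMeasure ha
  have h : (expMeasure a).real (Ioi x) = Real.exp (-(a * x)) := by
    rw [← compl_Iic, probReal_compl_eq_one_sub measurableSet_Iic, ← cdf_eq_real,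
      cdf_expMeasure_eq ha, if_pos hx, sub_sub_cancel]
  rw [← h, ofReal_measureReal]

lemma expMeasure_ae_pos (ha : 0 < a) : ∀ᵐ x ∂expMeasure a, 0 < x := by
  have := isProbabilityMeasure_expMeasure ha
  exact (mem_ae_iff_prob_eq_one measurableSet_Ioi).2 (by simp [expMeasure_Ioi ha le_rfl])

lemma clock_ae_pos (ha : 0 < a) (hb : 0 < b) :
    ∀ᵐ p ∂(expMeasure a).prod (expMeasure b), 0 < p.1 ∧ 0 < p.2 := by
  have := isProbabilityMeasure_expMeasure ha
  have := isProbabilityMeasure_expMeasure hb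
  filter_upwards [Measure.quasiMeasurePreserving_fst.ae (expMeasure_ae_pos ha),
    Measure.quasiMeasurePreserving_snd.ae (expMeasure_ae_pos hb)] with p h1 h2
  exact ⟨h1, h2⟩

/-- The second clock rings strictly before the first with probability `b / (a + b)`. -/
lemma measure_clock_lt (ha : 0 < a) (hb : 0 < b) :
    (expMeasure a).prod (expMeasure b) {p | p.2 < p.1} = ENNReal.ofReal (b / (a + b)) := by
  have := isProbabilityMeasure_expMeasure ha
  have := isProbabilityMeasure_expMeasure hb
  have hab := add_pos ha hb
  rw [Measure.prod_apply_symm (measurableSet_lt measurable_snd measurable_fst)]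
  have h1 : ∫⁻ s, expMeasure a ((fun x => (x, s)) ⁻¹' {p : ℝ × ℝ | p.2 < p.1}) ∂expMeasure b
      = ∫⁻ s, ENNReal.ofReal (Real.exp (-(a * s))) ∂expMeasure b := by
    refine lintegral_congr_ae ?_
    filter_upwards [expMeasure_ae_pos hb] with s hs
    exact expMeasure_Ioi ha hs.le
  rw [h1, expMeasure, gammaMeasure,
    lintegral_withDensity_eq_lintegral_mul _ (by exact (measurable_gammaPDFReal 1 b).ennreal_ofReal)
      (by fun_prop)]
  have h2 : ∀ s, (gammaPDF 1 b * fun s => ENNReal.ofReal (Real.exp (-(a * s)))) s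
      = ENNReal.ofReal (b / (a + b)) * exponentialPDF (a + b) s := by
    intro s
    change exponentialPDF b s * _ = _
    rcases lt_or_ge s 0 with hs | hs
    · rw [exponentialPDF_of_neg hs, exponentialPDF_of_neg hs, zero_mul, mul_zero]
    · rw [exponentialPDF_of_nonneg hs, exponentialPDF_of_nonneg hs, 
        ← ENNReal.ofReal_mul (by positivity), ← ENNReal.ofReal_mul (by positivity)]
      congr 1
      rw [mul_assoc, ← Real.exp_add, ← mul_assoc, div_mul_cancel₀ _ hab.ne']
      ring_nf
  rw [lintegral_congr h2, lintegral_const_mul _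
    (by exact (measurable_exponentialPDFReal _).ennreal_ofReal), lintegral_exponentialPDF_eq_one hab, mul_one]

lemma lintegral_clock_min (ha : 0 < a) (hb : 0 < b) :
    ∫⁻ p, ENNReal.ofReal (min p.1 p.2) ∂(expMeasure a).prod (expMeasure b)
      = ENNReal.ofReal (1 / (a + b)) := by
  have := isProbabilityMeasure_expMeasure ha
  have := isProbabilityMeasure_expMeasure hb
  have hab := add_pos ha hb
  rw [lintegral_eq_lintegral_meas_lt _ _ (by fun_prop)]
  · have h1 : ∀ x ∈ Ioi (0 : ℝ), (expMeasure a).prod (expMeasure b) {p | x < min p.1 p.2}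
        = ENNReal.ofReal (Real.exp (-(a + b) * x)) := by
      intro x (hx : 0 < x)
      have : {p : ℝ × ℝ | x < min p.1 p.2} = Ioi x ×ˢ Ioi x := by ext p; simp
      rw [this, Measure.prod_prod, expMeasure_Ioi ha hx.le, expMeasure_Ioi hb hx.le,
        ← ENNReal.ofReal_mul (by positivity), ← Real.exp_add]
      ring_nf
    rw [setLIntegral_congr_fun measurableSet_Ioi h1, ← ofReal_integral_eq_lintegral_ofReal
      (integrableOn_exp_mul_Ioi (by linarith) 0) (ae_of_all _ fun _ => by positivity),
      integral_exp_mul_Ioi (by linarith)]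
    rw [mul_zero, Real.exp_zero, neg_div_neg_eq]
  · filter_upwards [clock_ae_pos ha hb] with p h
    exact le_min h.1.le h.2.le

lemma integrable_clock_min (ha : 0 < a) (hb : 0 < b) :
    Integrable (fun p : ℝ × ℝ => min p.1 p.2) ((expMeasure a).prod (expMeasure b)) := by
  refine ⟨by fun_prop, (hasFiniteIntegral_iff_ofReal ?_).2 ?_⟩
  · filter_upwards [clock_ae_pos ha hb] with p h
    exact le_min h.1.le h.2.le
  · rw [lintegral_clock_min ha hb]; exact ENNReal.ofReal_lt_top

lemma integral_clock_min (ha : 0 < a) (hb : 0 < b) :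
    ∫ p, min p.1 p.2 ∂(expMeasure a).prod (expMeasure b) = 1 / (a + b) := by
  rw [integral_eq_lintegral_of_nonneg_ae _ (integrable_clock_min ha hb).1, lintegral_clock_min ha hb,
    ENNReal.toReal_ofReal (by positivity)]
  filter_upwards [clock_ae_pos ha hb] with p h
  exact le_min h.1.le h.2.le

end Clocks

/-! ### Means of one step -/

namespace Model

variable (M : Model)

/-- The value `v` collected from the requests of state `i` with length in `s`, per unit of time in
which the driver is open in state `i`. -/
def flow (i : Fin 2) (s : Set ℝ) (v : ℝ → ℝ) : ℝ := M.arrival i * ∫ τ in s, v τ ∂M.F i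

/-- The total rate of the two clocks that an open driver faces. -/
def clockRate (i : Fin 2) : ℝ := M.arrival i + M.switchRate i

lemma clockRate_pos (i : Fin 2) : 0 < M.clockRate i :=
  add_pos (M.arrival_pos i) (M.switchRate_pos i)

/-- Law of the two clocks of a step that starts in state `i`. -/
def clockLaw (i : Fin 2) : Measure (ℝ × ℝ) :=
  (expMeasure (M.arrival i)).prod (expMeasure (M.switchRate i))

instance (i : Fin 2) : IsProbabilityMeasure (M.clockLaw i) := by
  have := isProbabilityMeasure_expMeasure (M.arrival_pos i)
  have := isProbabilityMeasure_expMeasure (M.switchRate_pos i)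
  unfold clockLaw
  infer_instance

instance : IsProbabilityMeasure (volume.restrict (Icc (0 : ℝ) 1)) := ⟨by simp⟩

/-- Law of the trip length and of the uniform variable of a step that starts in state `i`. -/
def tripLaw (i : Fin 2) : Measure (ℝ × ℝ) := (M.F i).prod (volume.restrict (Icc (0 : ℝ) 1))

instance (i : Fin 2) : IsProbabilityMeasure (M.tripLaw i) := by
  unfold tripLaw
  infer_instance

/-- The clocks are independent of the trip. -/
lemma measurePreserving_draw (i : Fin 2) :
    MeasurePreserving (MeasurableEquiv.prodAssoc (α := ℝ) (β := ℝ) (γ := ℝ × ℝ))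
      ((M.clockLaw i).prod (M.tripLaw i)) (M.drawLaw i) := by
  have := isProbabilityMeasure_expMeasure (M.switchRate_pos i)
  exact measurePreserving_prodAssoc _ _ _

lemma integral_draw_mul (i : Fin 2) (φ ψ : ℝ × ℝ → ℝ) :
    ∫ x, φ (x.1, x.2.1) * ψ x.2.2 ∂M.drawLaw i
      = (∫ p, φ p ∂M.clockLaw i) * ∫ p, ψ p ∂M.tripLaw i := by
  rw [← integral_prod_mul, ← (M.measurePreserving_draw i).integral_comp']
  rfl

lemma integrable_draw_mul {i : Fin 2} {φ ψ : ℝ × ℝ → ℝ} (hφ : Integrable φ (M.clockLaw i))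
    (hψ : Integrable ψ (M.tripLaw i)) :
    Integrable (fun x : Draw => φ (x.1, x.2.1) * ψ x.2.2) (M.drawLaw i) := by
  rw [← (M.measurePreserving_draw i).integrable_comp_emb (MeasurableEquiv.measurableEmbedding _)]
  exact hφ.mul_prod hψ

lemma draw_ae_pos (i : Fin 2) : ∀ᵐ x ∂M.drawLaw i, 0 < x.1 ∧ 0 < x.2.1 ∧ 0 < x.2.2.1 := by
  have h : ∀ᵐ x ∂(M.clockLaw i).prod (M.tripLaw i), 0 < x.1.1 ∧ 0 < x.1.2 ∧ 0 < x.2.1 := by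
    have h1 : ∀ᵐ p ∂M.tripLaw i, 0 < p.1 := Measure.quasiMeasurePreserving_fst.ae (M.ae_pos i)
    filter_upwards [Measure.quasiMeasurePreserving_fst.ae
        (clock_ae_pos (M.arrival_pos i) (M.switchRate_pos i)),
      Measure.quasiMeasurePreserving_snd.ae h1] with p h1 h2
    exact ⟨h1.1, h1.2, h2⟩
  rw [← (M.measurePreserving_draw i).map_eq]
  exact (MeasurableEquiv.measurableEmbedding _).ae_map_iff.2 h

open Classical in
/-- The indicator that a request comes before the world switches. -/
def requestInd (p : ℝ × ℝ) : ℝ := if p.2 < p.1 then 0 else 1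

open Classical in
/-- The indicator that the world switches before a request comes. -/
def switchInd (p : ℝ × ℝ) : ℝ := if p.2 < p.1 then 1 else 0

lemma switchInd_eq : switchInd = ({p | p.2 < p.1} : Set (ℝ × ℝ)).indicator 1 := by
  ext p; simp [switchInd, indicator]

lemma requestInd_eq (p : ℝ × ℝ) : requestInd p = 1 - switchInd p := by
  simp only [requestInd, switchInd]; split_ifs <;> simp

lemma measurableSet_clock_lt : MeasurableSet {p : ℝ × ℝ | p.2 < p.1} :=
  measurableSet_lt measurable_snd measurable_fst

lemma integrable_switchInd (i : Fin 2) : Integrable switchInd (M.clockLaw i) := by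
  rw [switchInd_eq]
  exact (integrable_const (1 : ℝ)).indicator measurableSet_clock_lt

lemma integrable_requestInd (i : Fin 2) : Integrable requestInd (M.clockLaw i) := by
  rw [funext requestInd_eq]
  exact (integrable_const _).sub (M.integrable_switchInd i)

lemma integral_switchInd (i : Fin 2) :
    ∫ p, switchInd p ∂M.clockLaw i = M.switchRate i / M.clockRate i := by
  rw [switchInd_eq, integral_indicator_one measurableSet_clock_lt, measureReal_def, clockLaw,
    measure_clock_lt (M.arrival_pos i) (M.switchRate_pos i), ← clockRate, ENNReal.toReal_ofReal
    (div_pos (M.switchRate_pos i) (M.clockRate_pos i)).le]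

lemma integral_requestInd (i : Fin 2) :
    ∫ p, requestInd p ∂M.clockLaw i = M.arrival i / M.clockRate i := by
  rw [funext requestInd_eq, integral_sub (integrable_const _) (M.integrable_switchInd i),
    integral_switchInd]
  have := (M.clockRate_pos i).ne'
  simp
  field_simp
  simp [clockRate]

lemma integral_indicator_fst (i : Fin 2) {s : Set ℝ} (hs : MeasurableSet s) (v : ℝ → ℝ) :
    ∫ p, s.indicator v p.1 ∂M.tripLaw i = ∫ τ in s, v τ ∂M.F i := by
  rw [tripLaw, integral_fun_fst (s.indicator v), integral_indicator hs]
  simp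

variable {M} {i : Fin 2} {σ : Fin 2 → Set ℝ} {w : Fin 2 → ℝ → ℝ}

lemma integrable_indicator_fst {s : Set ℝ} (hs : MeasurableSet s) {v : ℝ → ℝ}
    (hv : Integrable v (M.F i)) : Integrable (fun p => s.indicator v p.1) (M.tripLaw i) :=
  (hv.indicator hs).comp_fst _

lemma integrable_switchProb : Integrable (M.switchProb i) (M.F i) := by
  refine Integrable.of_bound (C := 1) (by fun_prop) ?_
  filter_upwards [M.ae_pos i] with τ h
  rw [Real.norm_of_nonneg (M.switchProb_nonneg i h.le)]
  exact M.switchProb_le_one i τ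

lemma stepTime_eq (x : Draw) : stepTime σ i x
    = min x.1 x.2.1 * 1 + requestInd (x.1, x.2.1) * (σ i).indicator (fun τ => τ) x.2.2.1 := by
  obtain ⟨e, s, τ, u⟩ := x
  by_cases h : s < e
  · simp [stepTime, requestInd, h, h.le]
  · by_cases h2 : τ ∈ σ i <;> simp [stepTime, requestInd, h, h2, not_lt.1 h]

lemma stepPay_eq (x : Draw) : stepPay w σ i x
    = requestInd (x.1, x.2.1) * (σ i).indicator (w i) x.2.2.1 := by
  obtain ⟨e, s, τ, u⟩ := x
  by_cases h : s < e
  · simp [stepPay, requestInd, h]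
  · by_cases h2 : τ ∈ σ i <;> simp [stepPay, requestInd, h, h2]

open Classical in
lemma stepState_ind_eq (x : Draw) : (if M.stepState σ i x = i then (0 : ℝ) else 1)
    = switchInd (x.1, x.2.1) * 1 + requestInd (x.1, x.2.1) *
      ({p | p.1 ∈ σ i ∧ p.2 < M.switchProb i p.1} : Set (ℝ × ℝ)).indicator 1 x.2.2 := by
  obtain ⟨e, s, τ, u⟩ := x
  have hr : i.rev ≠ i := by fin_cases i <;> decide
  by_cases h : s < e
  · simp [stepState, requestInd, switchInd, h, hr]
  · by_cases h2 : τ ∈ σ i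
    · by_cases h3 : u < M.switchProb i τ <;>
        simp [stepState, requestInd, switchInd, h, h2, h3, hr]
    · simp [stepState, requestInd, switchInd, h, h2]

lemma integrable_stepTime (hσ : MeasurableSet (σ i)) :
    Integrable (stepTime σ i) (M.drawLaw i) := by
  rw [funext stepTime_eq]
  exact (M.integrable_draw_mul (φ := fun p => min p.1 p.2) (ψ := fun _ => 1)
    (integrable_clock_min (M.arrival_pos i) (M.switchRate_pos i)) (integrable_const _)).add
    (M.integrable_draw_mul (M.integrable_requestInd i) (integrable_indicator_fst hσ (M.F_mean i)))

lemma integral_stepTime (hσ : MeasurableSet (σ i)) :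
    ∫ x, stepTime σ i x ∂M.drawLaw i = (1 + M.flow i (σ i) fun τ => τ) / M.clockRate i := by
  rw [funext stepTime_eq, integral_add
    (M.integrable_draw_mul (φ := fun p => min p.1 p.2) (ψ := fun _ => 1)
      (integrable_clock_min (M.arrival_pos i) (M.switchRate_pos i)) (integrable_const _))
    (M.integrable_draw_mul (M.integrable_requestInd i) (integrable_indicator_fst hσ (M.F_mean i))),
    M.integral_draw_mul i (fun p => min p.1 p.2) (fun _ => 1),
    M.integral_draw_mul i requestInd (fun p => (σ i).indicator (fun τ => τ) p.1),
    integral_requestInd, M.integral_indicator_fst i hσ, clockLaw,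
    integral_clock_min (M.arrival_pos i) (M.switchRate_pos i), flow, clockRate]
  simp
  ring

lemma integrable_stepPay (hσ : MeasurableSet (σ i)) (hw : Integrable (w i) (M.F i)) :
    Integrable (stepPay w σ i) (M.drawLaw i) := by
  rw [funext stepPay_eq]
  exact M.integrable_draw_mul (M.integrable_requestInd i) (integrable_indicator_fst hσ hw)

lemma integral_stepPay (hσ : MeasurableSet (σ i)) :
    ∫ x, stepPay w σ i x ∂M.drawLaw i = M.flow i (σ i) (w i) / M.clockRate i := by
  rw [funext stepPay_eq, M.integral_draw_mul i requestInd (fun p => (σ i).indicator (w i) p.1),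
    integral_requestInd, M.integral_indicator_fst i hσ, flow]
  ring

lemma measurableSet_tripSwitch (hσ : MeasurableSet (σ i)) :
    MeasurableSet {p : ℝ × ℝ | p.1 ∈ σ i ∧ p.2 < M.switchProb i p.1} :=
  (measurable_fst hσ).inter (measurableSet_lt measurable_snd
    ((M.continuous_switchProb i).measurable.comp measurable_fst))

lemma integrable_tripSwitch (hσ : MeasurableSet (σ i)) :
    Integrable (({p | p.1 ∈ σ i ∧ p.2 < M.switchProb i p.1} : Set (ℝ × ℝ)).indicator
      (1 : ℝ × ℝ → ℝ)) (M.tripLaw i) :=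
  (integrable_const (1 : ℝ)).indicator (measurableSet_tripSwitch hσ)

/-- The probability that a trip is accepted and ends in the other state of the world. -/
lemma integral_tripSwitch (hσ : MeasurableSet (σ i)) :
    ∫ p, ({p | p.1 ∈ σ i ∧ p.2 < M.switchProb i p.1} : Set (ℝ × ℝ)).indicator (1 : ℝ × ℝ → ℝ) p
      ∂M.tripLaw i = ∫ τ in σ i, M.switchProb i τ ∂M.F i := by
  rw [tripLaw, integral_prod _ (integrable_tripSwitch hσ), ← integral_indicator hσ]
  refine integral_congr_ae ?_
  filter_upwards [M.ae_pos i] with τ hτ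
  by_cases h : τ ∈ σ i
  · have h1 : (fun u => ({p | p.1 ∈ σ i ∧ p.2 < M.switchProb i p.1} : Set (ℝ × ℝ)).indicator
        (1 : ℝ × ℝ → ℝ) (τ, u)) = (Iio (M.switchProb i τ)).indicator 1 := by
      ext u; simp [indicator, h]
    have h2 : Iio (M.switchProb i τ) ∩ Icc 0 1 = Ico 0 (M.switchProb i τ) := by
      ext u
      simp only [mem_inter_iff, mem_Iio, mem_Icc, mem_Ico]
      have := M.switchProb_le_one i τ
      constructor
      · rintro ⟨h, h', -⟩; exact ⟨h', h⟩
      · rintro ⟨h, h'⟩; exact ⟨h', h, by linarith⟩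
    rw [h1, integral_indicator_one measurableSet_Iio, measureReal_def,
      Measure.restrict_apply measurableSet_Iio, h2, Real.volume_Ico, sub_zero,
      ENNReal.toReal_ofReal (M.switchProb_nonneg i hτ.le), indicator_of_mem h]
  · simp [indicator, h]

open Classical in
lemma integral_stepState_ind (hσ : MeasurableSet (σ i)) :
    ∫ x, (if M.stepState σ i x = i then (0 : ℝ) else 1) ∂M.drawLaw i
      = (M.switchRate i + M.flow i (σ i) (M.switchProb i)) / M.clockRate i := by
  rw [funext stepState_ind_eq, integral_add
    (M.integrable_draw_mul (ψ := fun _ => 1) (M.integrable_switchInd i) (integrable_const _))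
    (M.integrable_draw_mul (M.integrable_requestInd i) (integrable_tripSwitch hσ)),
    M.integral_draw_mul i switchInd (fun _ => 1), M.integral_draw_mul i requestInd
      (({p | p.1 ∈ σ i ∧ p.2 < M.switchProb i p.1} : Set (ℝ × ℝ)).indicator 1),
    integral_requestInd, integral_switchInd, integral_tripSwitch hσ, flow]
  simp
  ring

lemma stepTime_ae_pos : ∀ᵐ x ∂M.drawLaw i, 0 < stepTime σ i x := by
  filter_upwards [M.draw_ae_pos i] with ⟨e, s, τ, u⟩ ⟨h1, h2, h3⟩
  dsimp only at h1 h2 h3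
  simp only [stepTime]
  split_ifs <;> linarith

/-- If the price of a trip is at most affine in its length, then the earnings of a step are at most
affine in its duration. -/
lemma abs_stepPay_le {K : ℝ} (hK : 0 ≤ K) (hw : ∀ τ, 0 < τ → |w i τ| ≤ K * (τ + 1)) :
    ∀ᵐ x ∂M.drawLaw i, |stepPay w σ i x| ≤ K * (stepTime σ i x + 1) := by
  filter_upwards [M.draw_ae_pos i] with ⟨e, s, τ, u⟩ ⟨h1, h2, h3⟩
  dsimp only at h1 h2 h3
  simp only [stepTime, stepPay]
  split_ifs
  · rw [abs_zero]; positivity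
  · exact (hw τ h3).trans (by gcongr; linarith)
  · rw [abs_zero]; positivity

lemma measurable_stepTime (hσ : MeasurableSet (σ i)) : Measurable (stepTime σ i) := by
  have h1 : MeasurableSet {x : Draw | x.2.1 < x.1} :=
    measurableSet_lt (by fun_prop) (by fun_prop)
  have h2 : MeasurableSet {x : Draw | x.2.2.1 ∈ σ i} :=
    (show Measurable fun x : Draw => x.2.2.1 by fun_prop) hσ
  exact Measurable.ite h1 (by fun_prop) (Measurable.ite h2 (by fun_prop) (by fun_prop))

lemma measurable_stepPay (hσ : MeasurableSet (σ i)) (hw : Measurable (w i)) :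
    Measurable (stepPay w σ i) := by
  have h1 : MeasurableSet {x : Draw | x.2.1 < x.1} :=
    measurableSet_lt (by fun_prop) (by fun_prop)
  have h2 : MeasurableSet {x : Draw | x.2.2.1 ∈ σ i} :=
    (show Measurable fun x : Draw => x.2.2.1 by fun_prop) hσ
  exact Measurable.ite h1 (by fun_prop) (Measurable.ite h2 (by fun_prop) (by fun_prop))

lemma measurable_stepState (hσ : MeasurableSet (σ i)) : Measurable (M.stepState σ i) := by
  have h1 : MeasurableSet {x : Draw | x.2.1 < x.1} :=
    measurableSet_lt (by fun_prop) (by fun_prop)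
  have h2 : MeasurableSet {x : Draw | x.2.2.1 ∈ σ i} :=
    (show Measurable fun x : Draw => x.2.2.1 by fun_prop) hσ
  have h3 : MeasurableSet {x : Draw | x.2.2.2 < M.switchProb i x.2.2.1} :=
    measurableSet_lt (by fun_prop) ((M.continuous_switchProb i).measurable.comp (by fun_prop))
  exact Measurable.ite h1 (by fun_prop) (Measurable.ite h2
    (Measurable.ite h3 (by fun_prop) (by fun_prop)) (by fun_prop))

end Model

/-! ### Sums over the steps that begin by a given time -/

section Pathwise

variable {S L : ℕ → ℝ} {t : ℝ}

/-- `1` if an event at time `s` happens by time `t`, and `0` otherwise. -/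
def byTime (t s : ℝ) : ℝ := (Iic t).indicator 1 s

lemma byTime_nonneg (t s : ℝ) : 0 ≤ byTime t s := indicator_nonneg (by simp) s

lemma byTime_of_le {t s : ℝ} (h : s ≤ t) : byTime t s = 1 := indicator_of_mem (mem_Iic.2 h) _

lemma byTime_of_lt {t s : ℝ} (h : t < s) : byTime t s = 0 :=
  indicator_of_notMem (notMem_Iic.2 h) _

lemma byTime_antitone (t : ℝ) : Antitone (byTime t) := by
  intro a b hab
  rcases le_or_gt b t with h | h
  · rw [byTime_of_le h, byTime_of_le (hab.trans h)]
  · rw [byTime_of_lt h]; exact byTime_nonneg _ _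

lemma measurable_byTime (t : ℝ) : Measurable (byTime t) :=
  measurable_one.indicator measurableSet_Iic

/-- Summation by parts. -/
lemma sum_mul_increment (J h : ℕ → ℝ) (N : ℕ) :
    ∑ n ∈ Finset.range N, J n * (h (n + 1) - h n)
      = J N * h N - J 0 * h 0 + ∑ n ∈ Finset.range N, (J n - J (n + 1)) * h (n + 1) := by
  induction N with
  | zero => simp
  | succ N ih => rw [Finset.sum_range_succ, ih, Finset.sum_range_succ]; ring

lemma sum_byTime_min_le (h0 : S 0 = 0) (hS : ∀ n, S (n + 1) = S n + L n) (hL : ∀ n, 0 ≤ L n)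
    (ht : 0 ≤ t) (N : ℕ) :
    ∑ n ∈ Finset.range N, byTime t (S n) * min (L n) 1 ≤ t + 1 := by
  suffices h : ∑ n ∈ Finset.range N, byTime t (S n) * min (L n) 1 ≤ min (S N) (t + 1) from
    h.trans (min_le_right _ _)
  induction N with
  | zero => simp [h0]; linarith
  | succ N ih =>
    rw [Finset.sum_range_succ, hS]
    have hm1 : min (L N) 1 ≤ L N := min_le_left _ _
    have hm2 : min (L N) 1 ≤ 1 := min_le_right _ _
    have hL := hL N
    rcases le_or_gt (S N) t with h | h
    · rw [byTime_of_le h, one_mul]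
      have := ih.trans (min_le_left _ _)
      exact le_min (by linarith) (by linarith)
    · rw [byTime_of_lt h, zero_mul, add_zero]
      exact ih.trans (min_le_min_right _ (by linarith))

/-- The steps that begin by time `t` cover the time up to `t`, and exceed it by at most the duration
of the step in progress at time `t`, unless there are more than `N` of them. -/
lemma abs_sum_byTime_sub_le (h0 : S 0 = 0) (hS : ∀ n, S (n + 1) = S n + L n) (hL : ∀ n, 0 ≤ L n)
    (ht : 0 ≤ t) (N : ℕ) :
    |∑ n ∈ Finset.range N, byTime t (S n) * L n - t|
      ≤ ∑ n ∈ Finset.range N, (byTime t (S n) - byTime t (S (n + 1))) * L n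
        + t * byTime t (S N) := by
  have hSn : ∀ n, 0 ≤ S n := fun n => by
    induction n with
    | zero => rw [h0]
    | succ n ih => rw [hS]; exact add_nonneg ih (hL n)
  have key : ∑ n ∈ Finset.range N, byTime t (S n) * L n - t
      = byTime t (S N) * (S N - t)
        + ∑ n ∈ Finset.range N, (byTime t (S n) - byTime t (S (n + 1))) * (S (n + 1) - t) := by
    have := sum_mul_increment (fun n => byTime t (S n)) (fun n => S n - t) N
    simp only [h0, byTime_of_le ht, hS] at this
    simp only [hS]
    rw [Finset.sum_congr rfl (g := fun n => byTime t (S n) * L n) (fun n _ => by ring)] at this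
    linarith
  rw [key]
  refine (abs_add_le _ _).trans ?_
  rw [add_comm]
  refine add_le_add ((Finset.abs_sum_le_sum_abs _ _).trans (Finset.sum_le_sum fun n _ => ?_)) ?_
  · rcases le_or_gt (S n) t with h | h
    · rcases le_or_gt (S (n + 1)) t with h' | h'
      · simp [byTime_of_le h, byTime_of_le h']
      · rw [byTime_of_le h, byTime_of_lt h', sub_zero, one_mul, one_mul, abs_of_pos (by linarith)]
        rw [hS] at h' ⊢
        linarith
    · have h' : t < S (n + 1) := by rw [hS]; linarith [hL n]
      simp [byTime_of_lt h, byTime_of_lt h']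
  · rcases le_or_gt (S N) t with h | h
    · rw [byTime_of_le h, one_mul, mul_one, abs_of_nonpos (by linarith)]
      linarith [hSn N]
    · simp [byTime_of_lt h]

/-- The duration of the step in progress at time `t` is at most `b`, up to the total duration of the
steps of duration more than `b`. -/
lemma sum_straddle_le (h0 : S 0 = 0) (hS : ∀ n, S (n + 1) = S n + L n) (hL : ∀ n, 0 ≤ L n)
    (ht : 0 ≤ t) {b : ℝ} (hb : 0 ≤ b) (N : ℕ) :
    ∑ n ∈ Finset.range N, (byTime t (S n) - byTime t (S (n + 1))) * L n
      ≤ b + ∑ n ∈ Finset.range N, byTime t (S n) * (Ioi b).indicator id (L n) := by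
  have h1 : ∑ n ∈ Finset.range N, (byTime t (S n) - byTime t (S (n + 1))) * b ≤ b := by
    rw [← Finset.sum_mul, Finset.sum_range_sub', h0, byTime_of_le ht]
    nlinarith [byTime_nonneg t (S N)]
  refine le_trans ?_ (add_le_add_left h1 _)
  rw [← Finset.sum_add_distrib]
  refine Finset.sum_le_sum fun n _ => ?_
  have hmono : byTime t (S (n + 1)) ≤ byTime t (S n) :=
    byTime_antitone t (by rw [hS]; linarith [hL n])
  rcases le_or_gt (L n) b with h | h
  · rw [indicator_of_notMem (notMem_Ioi.2 h), mul_zero, add_zero]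
    exact mul_le_mul_of_nonneg_left h (sub_nonneg.2 hmono)
  · rw [indicator_of_mem (mem_Ioi.2 h), id]
    have := mul_nonneg (sub_nonneg.2 hmono) hb
    nlinarith [hL n, byTime_nonneg t (S (n + 1))]

/-- The earnings from the steps that are finished by time `t` differ from `g t` by the sum of the
increments `pay - g L + Δh` over the steps that begin by time `t`, up to an error that stems from
the step in progress at time `t`. -/
lemma abs_sum_pay_sub_le (h0 : S 0 = 0) (hS : ∀ n, S (n + 1) = S n + L n) (hL : ∀ n, 0 ≤ L n)
    (ht : 0 ≤ t) {b : ℝ} (hb : 0 ≤ b) {pay h : ℕ → ℝ} {K H : ℝ} (hK : 0 ≤ K)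
    (hpay : ∀ n, |pay n| ≤ K * (L n + 1)) (hh : ∀ n, |h n| ≤ H) (g : ℝ) (N : ℕ) :
    |∑ n ∈ Finset.range N, byTime t (S (n + 1)) * pay n
        - ∑ n ∈ Finset.range N, byTime t (S n) * (pay n - g * L n + (h (n + 1) - h n)) - g * t|
      ≤ (|g| + K) * (b + ∑ n ∈ Finset.range N, byTime t (S n) * (Ioi b).indicator id (L n))
        + |g| * (t * byTime t (S N)) + (2 * H + K) := by
  set J : ℕ → ℝ := fun n => byTime t (S n) with hJ
  have hmono : ∀ n, J (n + 1) ≤ J n := fun n =>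
    byTime_antitone t (by rw [hS]; linarith [hL n])
  have hJ0 : J 0 = 1 := by simp only [hJ, h0, byTime_of_le ht]
  have htel : ∑ n ∈ Finset.range N, (J n - J (n + 1)) = 1 - J N := by
    rw [Finset.sum_range_sub', hJ0]
  have hJN : 0 ≤ J N := byTime_nonneg _ _
  have hE := sum_straddle_le h0 hS hL ht hb N
  have hT := abs_sum_byTime_sub_le h0 hS hL ht N
  set E := ∑ n ∈ Finset.range N, (J n - J (n + 1)) * L n with hEdef
  have hP : |∑ n ∈ Finset.range N, (J n - J (n + 1)) * pay n| ≤ K * (E + 1) := by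
    calc _ ≤ ∑ n ∈ Finset.range N, (J n - J (n + 1)) * (K * (L n + 1)) := by
          refine (Finset.abs_sum_le_sum_abs _ _).trans (Finset.sum_le_sum fun n _ => ?_)
          rw [abs_mul, abs_of_nonneg (sub_nonneg.2 (hmono n))]
          exact mul_le_mul_of_nonneg_left (hpay n) (sub_nonneg.2 (hmono n))
      _ = K * (E + (1 - J N)) := by
          rw [← htel, hEdef, ← Finset.sum_add_distrib, Finset.mul_sum]
          exact Finset.sum_congr rfl fun n _ => by ring
      _ ≤ _ := mul_le_mul_of_nonneg_left (by linarith) hK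
  have hH : |∑ n ∈ Finset.range N, J n * (h (n + 1) - h n)| ≤ 2 * H := by
    rw [sum_mul_increment, hJ0, one_mul]
    have e1 : |J N * h N| ≤ J N * H := by
      rw [abs_mul, abs_of_nonneg hJN]; exact mul_le_mul_of_nonneg_left (hh N) hJN
    have e2 : |∑ n ∈ Finset.range N, (J n - J (n + 1)) * h (n + 1)| ≤ (1 - J N) * H := by
      rw [← htel, Finset.sum_mul]
      refine (Finset.abs_sum_le_sum_abs _ _).trans (Finset.sum_le_sum fun n _ => ?_)
      rw [abs_mul, abs_of_nonneg (sub_nonneg.2 (hmono n))]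
      exact mul_le_mul_of_nonneg_left (hh _) (sub_nonneg.2 (hmono n))
    have e3 := hh 0
    rw [abs_le] at e1 e2 e3 ⊢
    constructor <;> linarith
  have hsplit : ∑ n ∈ Finset.range N, J (n + 1) * pay n
      - ∑ n ∈ Finset.range N, J n * (pay n - g * L n + (h (n + 1) - h n)) - g * t
      = g * (∑ n ∈ Finset.range N, J n * L n - t) - ∑ n ∈ Finset.range N, J n * (h (n + 1) - h n)
        - ∑ n ∈ Finset.range N, (J n - J (n + 1)) * pay n := by
    have : ∑ n ∈ Finset.range N, J (n + 1) * pay n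
        - ∑ n ∈ Finset.range N, J n * (pay n - g * L n + (h (n + 1) - h n))
        = g * ∑ n ∈ Finset.range N, J n * L n - ∑ n ∈ Finset.range N, J n * (h (n + 1) - h n)
        - ∑ n ∈ Finset.range N, (J n - J (n + 1)) * pay n := by
      rw [Finset.mul_sum, ← Finset.sum_sub_distrib, ← Finset.sum_sub_distrib,
        ← Finset.sum_sub_distrib]
      exact Finset.sum_congr rfl fun n _ => by ring
    rw [this]; ring
  change |∑ n ∈ Finset.range N, J (n + 1) * pay n
      - ∑ n ∈ Finset.range N, J n * (pay n - g * L n + (h (n + 1) - h n)) - g * t| ≤ _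
  rw [hsplit]
  have hgT := mul_le_mul_of_nonneg_left hT (abs_nonneg g)
  rw [← abs_mul] at hgT
  have hE' := mul_le_mul_of_nonneg_left hE (add_nonneg (abs_nonneg g) hK)
  have a1 := abs_sub (g * (∑ n ∈ Finset.range N, J n * L n - t)
    - ∑ n ∈ Finset.range N, J n * (h (n + 1) - h n))
    (∑ n ∈ Finset.range N, (J n - J (n + 1)) * pay n)
  have a2 := abs_sub (g * (∑ n ∈ Finset.range N, J n * L n - t))
    (∑ n ∈ Finset.range N, J n * (h (n + 1) - h n))
  linarith

end Pathwise

/-! ### The Markov renewal process of the driver -/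

namespace Model

variable {M : Model} {σ : Fin 2 → Set ℝ} {i₀ : Fin 2}

section Renewal

variable (M σ i₀) in
/-- The value of `φ` at the state in which step `n` begins and at the randomness of that step. -/
def atStep {β : Type*} (φ : Fin 2 → Draw → β) (n : ℕ) (ω : Path) : β :=
  φ (M.stateAt σ i₀ ω n) (ω (n, M.stateAt σ i₀ ω n))

lemma timeAt_succ (ω : Path) (n : ℕ) :
    M.timeAt σ i₀ ω (n + 1) = M.timeAt σ i₀ ω n + M.atStep σ i₀ (stepTime σ) n ω := by
  rw [timeAt, Finset.sum_range_succ]; rfl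

lemma timeAt_zero (ω : Path) : M.timeAt σ i₀ ω 0 = 0 := by simp [timeAt]

lemma measurable_atStep_of {β : Type*} [MeasurableSpace β] {φ : Fin 2 → Draw → β}
    (hφ : ∀ i, Measurable (φ i)) {n : ℕ} (hX : Measurable fun ω => M.stateAt σ i₀ ω n) :
    Measurable (M.atStep σ i₀ φ n) := by
  have h : Measurable fun p : Fin 2 × Path => φ p.1 (p.2 (n, p.1)) :=
    measurable_from_prod_countable_right fun i => (hφ i).comp (measurable_pi_apply (n, i))
  exact h.comp (hX.prodMk measurable_id)

lemma measurable_stateAt (hσ : ∀ i, MeasurableSet (σ i)) (n : ℕ) :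
    Measurable fun ω => M.stateAt σ i₀ ω n := by
  induction n with
  | zero => exact measurable_const
  | succ n ih => exact measurable_atStep_of (fun i => measurable_stepState (hσ i)) ih

lemma measurable_atStep (hσ : ∀ i, MeasurableSet (σ i)) {β : Type*} [MeasurableSpace β]
    {φ : Fin 2 → Draw → β} (hφ : ∀ i, Measurable (φ i)) (n : ℕ) :
    Measurable (M.atStep σ i₀ φ n) :=
  measurable_atStep_of hφ (measurable_stateAt hσ n)

lemma measurable_timeAt (hσ : ∀ i, MeasurableSet (σ i)) (n : ℕ) :
    Measurable fun ω => M.timeAt σ i₀ ω n :=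
  Finset.measurable_sum _ fun k _ =>
    measurable_atStep hσ (fun i => measurable_stepTime (hσ i)) k

lemma stateAt_congr {ω ω' : Path} (n : ℕ) (h : ∀ k < n, ∀ i, ω (k, i) = ω' (k, i)) :
    M.stateAt σ i₀ ω n = M.stateAt σ i₀ ω' n := by
  induction n with
  | zero => rfl
  | succ n ih =>
    have := ih fun k hk => h k (hk.trans n.lt_succ_self)
    simp only [stateAt, this, h n n.lt_succ_self]

lemma timeAt_congr {ω ω' : Path} (n : ℕ) (h : ∀ k < n, ∀ i, ω (k, i) = ω' (k, i)) :
    M.timeAt σ i₀ ω n = M.timeAt σ i₀ ω' n := by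
  refine Finset.sum_congr rfl fun k hk => ?_
  have hk := Finset.mem_range.1 hk
  rw [stateAt_congr k fun l hl => h l (hl.trans hk), h k hk]

/-- The state and the time at the beginning of step `n` are independent of the randomness of that
step, as they depend on the randomness of the earlier steps only. -/
lemma indepFun_start (hσ : ∀ i, MeasurableSet (σ i)) (n : ℕ) (i : Fin 2) :
    IndepFun (fun ω => (M.stateAt σ i₀ ω n, M.timeAt σ i₀ ω n)) (fun ω => ω (n, i)) M.pathLaw := by
  classical
  have hind : iIndepFun (fun (p : ℕ × Fin 2) (ω : Path) => ω p) M.pathLaw :=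
    iIndepFun_infinitePi (P := fun p : ℕ × Fin 2 => M.drawLaw p.2) (X := fun _ => id)
      fun _ => measurable_id
  set A : Finset (ℕ × Fin 2) := Finset.range n ×ˢ Finset.univ with hA
  have hdisj : Disjoint A {(n, i)} := by simp [hA]
  have h := hind.indepFun_finset A {(n, i)} hdisj fun p => measurable_pi_apply p
  set ext : (A → Draw) → Path := fun x p => if hp : p ∈ A then x ⟨p, hp⟩ else 0 with hext
  have hextm : Measurable ext := by
    refine measurable_pi_lambda _ fun p => ?_
    by_cases hp : p ∈ A
    · simpa [hext, hp] using measurable_pi_apply (⟨p, hp⟩ : A)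
    · simp [hext, hp]
  have hstart : Measurable fun ω => (M.stateAt σ i₀ ω n, M.timeAt σ i₀ ω n) :=
    (measurable_stateAt hσ n).prodMk (measurable_timeAt hσ n)
  have h' := h.comp (hstart.comp hextm)
    (measurable_pi_apply (⟨(n, i), Finset.mem_singleton_self _⟩ : ({(n, i)} : Finset (ℕ × Fin 2))))
  convert! h' using 1
  ext1 ω
  have hag : ∀ k < n, ∀ j, ω (k, j) = ext (fun p : A => ω p) (k, j) := by
    intro k hk j
    simp [hext, hA, hk]
  simp only [Function.comp_apply]
  rw [← stateAt_congr n hag, ← timeAt_congr n hag]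

variable (M σ i₀) in
/-- The probability that step `n` begins by time `t` and in state `i`. -/
def startProb (t : ℝ) (n : ℕ) (i : Fin 2) : ℝ :=
  M.pathLaw.real {ω | M.stateAt σ i₀ ω n = i ∧ M.timeAt σ i₀ ω n ≤ t}

lemma startProb_nonneg (t : ℝ) (n : ℕ) (i : Fin 2) : 0 ≤ M.startProb σ i₀ t n i :=
  measureReal_nonneg

lemma byTime_mul_atStep (φ : Fin 2 → Draw → ℝ) (t : ℝ) (n : ℕ) (ω : Path) :
    byTime t (M.timeAt σ i₀ ω n) * M.atStep σ i₀ φ n ω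
      = ∑ i, ({p | p.1 = i ∧ p.2 ≤ t} : Set (Fin 2 × ℝ)).indicator (1 : Fin 2 × ℝ → ℝ)
          (M.stateAt σ i₀ ω n, M.timeAt σ i₀ ω n) * φ i (ω (n, i)) := by
  rw [Finset.sum_eq_single (M.stateAt σ i₀ ω n)]
  · simp [byTime, atStep, indicator]
  · intro i _ hi
    simp [hi.symm]
  · simp

lemma measurableSet_start (i : Fin 2) (t : ℝ) :
    MeasurableSet {p : Fin 2 × ℝ | p.1 = i ∧ p.2 ≤ t} :=
  (measurableSet_eq_fun measurable_fst measurable_const).inter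
    (measurableSet_le measurable_snd measurable_const)

lemma integrable_comp_draw {φ : Draw → ℝ} {i : Fin 2} (hφ : Integrable φ (M.drawLaw i)) (n : ℕ) :
    Integrable (fun ω : Path => φ (ω (n, i))) M.pathLaw :=
  (measurePreserving_eval_infinitePi (fun p : ℕ × Fin 2 => M.drawLaw p.2)
    (n, i)).integrable_comp_of_integrable hφ

lemma integral_comp_draw {φ : Draw → ℝ} {i : Fin 2} (hφ : Integrable φ (M.drawLaw i)) (n : ℕ) :
    ∫ ω : Path, φ (ω (n, i)) ∂M.pathLaw = ∫ x, φ x ∂M.drawLaw i := by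
  have h := (measurePreserving_eval_infinitePi (fun p : ℕ × Fin 2 => M.drawLaw p.2) (n, i))
  have h1 := hφ.1
  rw [← h.map_eq] at h1 ⊢
  rw [integral_map h.measurable.aemeasurable h1]
  rfl

lemma indepFun_start_mul (hσ : ∀ i, MeasurableSet (σ i)) {φ : Draw → ℝ} (hm : Measurable φ)
    (t : ℝ) (n : ℕ) (i : Fin 2) :
    IndepFun (fun ω => ({p | p.1 = i ∧ p.2 ≤ t} : Set (Fin 2 × ℝ)).indicator (1 : Fin 2 × ℝ → ℝ)
      (M.stateAt σ i₀ ω n, M.timeAt σ i₀ ω n)) (fun ω => φ (ω (n, i))) M.pathLaw :=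
  (indepFun_start hσ n i).comp (measurable_one.indicator (measurableSet_start i t)) hm

lemma integrable_start_ind (hσ : ∀ i, MeasurableSet (σ i)) (t : ℝ) (n : ℕ) (i : Fin 2) :
    Integrable (fun ω => ({p | p.1 = i ∧ p.2 ≤ t} : Set (Fin 2 × ℝ)).indicator
      (1 : Fin 2 × ℝ → ℝ) (M.stateAt σ i₀ ω n, M.timeAt σ i₀ ω n)) M.pathLaw := by
  refine Integrable.of_bound (C := 1) ?_ (ae_of_all _ fun ω => ?_)
  · exact ((measurable_one.indicator (measurableSet_start i t)).comp
      ((measurable_stateAt hσ n).prodMk (measurable_timeAt hσ n))).aestronglyMeasurable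
  · exact (norm_indicator_le_norm_self _ _).trans (by simp)

lemma integrable_start_mul (hσ : ∀ i, MeasurableSet (σ i)) {φ : Draw → ℝ} (hm : Measurable φ)
    {i : Fin 2} (hφ : Integrable φ (M.drawLaw i)) (t : ℝ) (n : ℕ) :
    Integrable (fun ω => ({p | p.1 = i ∧ p.2 ≤ t} : Set (Fin 2 × ℝ)).indicator
      (1 : Fin 2 × ℝ → ℝ) (M.stateAt σ i₀ ω n, M.timeAt σ i₀ ω n) * φ (ω (n, i))) M.pathLaw :=
  (indepFun_start_mul hσ hm t n i).integrable_mul (integrable_start_ind hσ t n i)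
    (integrable_comp_draw hφ n)

lemma integrable_byTime_mul_atStep (hσ : ∀ i, MeasurableSet (σ i)) {φ : Fin 2 → Draw → ℝ}
    (hm : ∀ i, Measurable (φ i)) (hφ : ∀ i, Integrable (φ i) (M.drawLaw i)) (t : ℝ) (n : ℕ) :
    Integrable (fun ω => byTime t (M.timeAt σ i₀ ω n) * M.atStep σ i₀ φ n ω) M.pathLaw := by
  simp only [byTime_mul_atStep]
  exact integrable_finsetSum _ fun i _ => integrable_start_mul hσ (hm i) (hφ i) t n

lemma integral_byTime_mul_atStep (hσ : ∀ i, MeasurableSet (σ i)) {φ : Fin 2 → Draw → ℝ}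
    (hm : ∀ i, Measurable (φ i)) (hφ : ∀ i, Integrable (φ i) (M.drawLaw i)) (t : ℝ) (n : ℕ) :
    ∫ ω, byTime t (M.timeAt σ i₀ ω n) * M.atStep σ i₀ φ n ω ∂M.pathLaw
      = ∑ i, M.startProb σ i₀ t n i * ∫ x, φ i x ∂M.drawLaw i := by
  simp only [byTime_mul_atStep]
  rw [integral_finsetSum _ fun i _ => integrable_start_mul hσ (hm i) (hφ i) t n]
  refine Finset.sum_congr rfl fun i _ => ?_
  rw [(indepFun_start_mul hσ (hm i) t n i).integral_fun_mul_eq_mul_integral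
    (integrable_start_ind hσ t n i).1 (integrable_comp_draw (hφ i) n).1, integral_comp_draw (hφ i)]
  congr 1
  have hset : MeasurableSet {ω | M.stateAt σ i₀ ω n = i ∧ M.timeAt σ i₀ ω n ≤ t} :=
    ((measurable_stateAt hσ n).prodMk (measurable_timeAt hσ n)) (measurableSet_start i t)
  rw [startProb, ← integral_indicator_one hset]
  rfl

lemma atStep_ae {p : Fin 2 → Draw → Prop} (hp : ∀ i, ∀ᵐ x ∂M.drawLaw i, p i x) :
    ∀ᵐ ω ∂M.pathLaw, ∀ n, M.atStep σ i₀ p n ω := by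
  have h : ∀ᵐ ω ∂M.pathLaw, ∀ q : ℕ × Fin 2, p q.2 (ω q) := by
    refine ae_all_iff.2 fun q => ?_
    exact (measurePreserving_eval_infinitePi (fun q : ℕ × Fin 2 => M.drawLaw q.2)
      q).quasiMeasurePreserving.ae (hp q.2)
  filter_upwards [h] with ω h n
  exact h (n, _)

end Renewal

/-! ### The renewal-reward theorem -/

section Reward

lemma stepTime_nonneg_ae : ∀ᵐ ω ∂M.pathLaw, ∀ n, 0 ≤ M.atStep σ i₀ (stepTime σ) n ω := by
  filter_upwards [atStep_ae (σ := σ) (i₀ := i₀) fun i => stepTime_ae_pos (M := M) (σ := σ)]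
    with ω h n
  exact (h n).le

lemma integrable_byTime_timeAt (hσ : ∀ i, MeasurableSet (σ i)) (t : ℝ) (n : ℕ) :
    Integrable (fun ω => byTime t (M.timeAt σ i₀ ω n)) M.pathLaw := by
  simpa [atStep] using integrable_byTime_mul_atStep (M := M) (i₀ := i₀) hσ (φ := fun _ _ => 1)
    (fun _ => measurable_const) (fun _ => integrable_const _) t n

lemma integral_byTime_timeAt (hσ : ∀ i, MeasurableSet (σ i)) (t : ℝ) (n : ℕ) :
    ∫ ω, byTime t (M.timeAt σ i₀ ω n) ∂M.pathLaw = ∑ i, M.startProb σ i₀ t n i := by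
  simpa [atStep] using integral_byTime_mul_atStep (M := M) (i₀ := i₀) hσ (φ := fun _ _ => 1)
    (fun _ => measurable_const) (fun _ => integrable_const _) t n

lemma integral_sum_byTime_mul_atStep (hσ : ∀ i, MeasurableSet (σ i)) {φ : Fin 2 → Draw → ℝ}
    (hm : ∀ i, Measurable (φ i)) (hφ : ∀ i, Integrable (φ i) (M.drawLaw i)) (t : ℝ) (N : ℕ) :
    ∫ ω, ∑ n ∈ Finset.range N, byTime t (M.timeAt σ i₀ ω n) * M.atStep σ i₀ φ n ω ∂M.pathLaw
      = ∑ n ∈ Finset.range N, ∑ i, M.startProb σ i₀ t n i * ∫ x, φ i x ∂M.drawLaw i := by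
  rw [integral_finsetSum _ fun n _ => integrable_byTime_mul_atStep hσ hm hφ t n]
  exact Finset.sum_congr rfl fun n _ => integral_byTime_mul_atStep hσ hm hφ t n

lemma integrable_sum_byTime_mul_atStep (hσ : ∀ i, MeasurableSet (σ i)) {φ : Fin 2 → Draw → ℝ}
    (hm : ∀ i, Measurable (φ i)) (hφ : ∀ i, Integrable (φ i) (M.drawLaw i)) (t : ℝ) (N : ℕ) :
    Integrable (fun ω => ∑ n ∈ Finset.range N,
      byTime t (M.timeAt σ i₀ ω n) * M.atStep σ i₀ φ n ω) M.pathLaw :=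
  integrable_finsetSum _ fun n _ => integrable_byTime_mul_atStep hσ hm hφ t n

/-- The expected number of steps that begin by time `t` grows at most linearly in `t`, since the
duration of a step, capped at `1`, has a positive mean. -/
lemma exists_sum_startProb_le (hσ : ∀ i, MeasurableSet (σ i)) :
    ∃ c > 0, ∀ i₀ t, 0 ≤ t → ∀ N,
      ∑ n ∈ Finset.range N, ∑ i, M.startProb σ i₀ t n i ≤ c * (t + 1) := by
  set φ : Fin 2 → Draw → ℝ := fun i x => min (stepTime σ i x) 1 with hφ
  have hm : ∀ i, Measurable (φ i) := fun i => (measurable_stepTime (hσ i)).min measurable_const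
  have hint : ∀ i, Integrable (φ i) (M.drawLaw i) := fun i =>
    (integrable_stepTime (hσ i)).inf (integrable_const 1)
  have hpos : ∀ i, 0 < ∫ x, φ i x ∂M.drawLaw i := fun i => by
    have hae : ∀ᵐ x ∂M.drawLaw i, 0 < φ i x := by
      filter_upwards [stepTime_ae_pos (M := M) (σ := σ)] with x hx using lt_min hx one_pos
    rw [integral_pos_iff_support_of_nonneg_ae (hae.mono fun _ h => h.le) (hint i)]
    have : Function.support (φ i) =ᵐ[M.drawLaw i] univ :=
      eventuallyEq_univ.2 (hae.mono fun x hx => hx.ne')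
    rw [measure_congr this]
    simp
  obtain ⟨c, hc, hc'⟩ : ∃ c > 0, ∀ i, c ≤ ∫ x, φ i x ∂M.drawLaw i :=
    ⟨min (∫ x, φ 0 x ∂M.drawLaw 0) (∫ x, φ 1 x ∂M.drawLaw 1), lt_min (hpos 0) (hpos 1),
      fun i => by fin_cases i <;> simp⟩
  refine ⟨c⁻¹, inv_pos.2 hc, fun i₀ t ht N => ?_⟩
  have h1 : ∫ ω, ∑ n ∈ Finset.range N, byTime t (M.timeAt σ i₀ ω n) * M.atStep σ i₀ φ n ω
      ∂M.pathLaw ≤ ∫ _, (t + 1) ∂M.pathLaw := by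
    refine integral_mono_ae (integrable_sum_byTime_mul_atStep hσ hm hint t N)
      (integrable_const _) ?_
    filter_upwards [stepTime_nonneg_ae (M := M) (σ := σ) (i₀ := i₀)] with ω hω
    exact sum_byTime_min_le (timeAt_zero ω) (timeAt_succ ω) hω ht N
  rw [integral_sum_byTime_mul_atStep hσ hm hint] at h1
  have h2 : c * ∑ n ∈ Finset.range N, ∑ i, M.startProb σ i₀ t n i ≤ t + 1 := by
    refine le_trans ?_ (h1.trans_eq (by simp))
    rw [Finset.mul_sum]
    refine Finset.sum_le_sum fun n _ => ?_
    rw [Finset.mul_sum]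
    refine Finset.sum_le_sum fun i _ => ?_
    rw [mul_comm]
    exact mul_le_mul_of_nonneg_left (hc' i) (startProb_nonneg t n i)
  rw [inv_mul_eq_div, le_div_iff₀' hc]
  exact h2

lemma summable_startProb (hσ : ∀ i, MeasurableSet (σ i)) {t : ℝ} (ht : 0 ≤ t) :
    Summable fun n => ∑ i, M.startProb σ i₀ t n i := by
  obtain ⟨c, -, hc⟩ := exists_sum_startProb_le (M := M) hσ
  exact summable_of_sum_range_le (fun n => Finset.sum_nonneg fun i _ => startProb_nonneg t n i)
    (hc i₀ t ht)

lemma tendsto_integral_long_step (hσ : ∀ i, MeasurableSet (σ i)) (i : Fin 2) :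
    Tendsto (fun b : ℝ => ∫ x, (Ioi b).indicator id (stepTime σ i x) ∂M.drawLaw i) atTop (𝓝 0) := by
  have h := tendsto_integral_filter_of_dominated_convergence (μ := M.drawLaw i) (l := atTop)
    (F := fun (b : ℝ) x => (Ioi b).indicator id (stepTime σ i x)) (f := fun _ => 0)
    (fun x => |stepTime σ i x|) ?_ ?_ (integrable_stepTime (hσ i)).abs ?_
  · simpa using h
  · exact Eventually.of_forall fun b => ((measurable_id.indicator measurableSet_Ioi).comp
      (measurable_stepTime (hσ i))).aestronglyMeasurable
  · exact Eventually.of_forall fun b => ae_of_all _ fun x => norm_indicator_le_norm_self _ _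
  · refine ae_of_all _ fun x => tendsto_const_nhds.congr' ?_
    filter_upwards [eventually_ge_atTop (stepTime σ i x)] with b hb
    rw [indicator_of_notMem (notMem_Ioi.2 hb)]

variable {w : Fin 2 → ℝ → ℝ} {K : ℝ}

lemma earnings_eq (t : ℝ) (ω : Path) : M.earnings w σ i₀ t ω
    = ∑' n, byTime t (M.timeAt σ i₀ ω (n + 1)) * M.atStep σ i₀ (stepPay w σ) n ω := by
  unfold earnings
  congr 1
  ext n
  by_cases h : M.timeAt σ i₀ ω (n + 1) ≤ t
  · rw [if_pos h, byTime_of_le h, one_mul]; rfl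
  · rw [if_neg h, byTime_of_lt (not_le.1 h), zero_mul]

lemma norm_byTime_succ_mul_le {φ : Fin 2 → Draw → ℝ} (t : ℝ) :
    ∀ᵐ ω ∂M.pathLaw, ∀ n, ‖byTime t (M.timeAt σ i₀ ω (n + 1)) * M.atStep σ i₀ φ n ω‖
      ≤ byTime t (M.timeAt σ i₀ ω n) * M.atStep σ i₀ (fun i x => |φ i x|) n ω := by
  filter_upwards [stepTime_nonneg_ae (M := M) (σ := σ) (i₀ := i₀)] with ω hω n
  rw [norm_mul, Real.norm_of_nonneg (byTime_nonneg _ _)]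
  refine mul_le_mul_of_nonneg_right (byTime_antitone t ?_) (norm_nonneg _)
  rw [timeAt_succ]
  linarith [hω n]

lemma integrable_byTime_succ_mul (hσ : ∀ i, MeasurableSet (σ i)) {φ : Fin 2 → Draw → ℝ}
    (hm : ∀ i, Measurable (φ i)) (hφ : ∀ i, Integrable (φ i) (M.drawLaw i)) (t : ℝ) (n : ℕ) :
    Integrable (fun ω => byTime t (M.timeAt σ i₀ ω (n + 1)) * M.atStep σ i₀ φ n ω) M.pathLaw := by
  refine (integrable_byTime_mul_atStep hσ (fun i => (hm i).abs) (fun i => (hφ i).abs) t n).mono' ?_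
    ((norm_byTime_succ_mul_le t).mono fun ω h => h n)
  exact (((measurable_byTime t).comp (measurable_timeAt hσ (n + 1))).mul
    (measurable_atStep hσ hm n)).aestronglyMeasurable

/-- The expected earnings by time `t` are the sum of the expected earnings of the steps. -/
lemma hasSum_integral_earnings (hσ : ∀ i, MeasurableSet (σ i)) (hw : ∀ i, Measurable (w i))
    (hwi : ∀ i, Integrable (w i) (M.F i)) {t : ℝ} (ht : 0 ≤ t) :
    HasSum (fun n => ∫ ω, byTime t (M.timeAt σ i₀ ω (n + 1)) * M.atStep σ i₀ (stepPay w σ) n ω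
      ∂M.pathLaw) (∫ ω, M.earnings w σ i₀ t ω ∂M.pathLaw) := by
  have hm : ∀ i, Measurable (stepPay w σ i) := fun i => measurable_stepPay (hσ i) (hw i)
  have hφ : ∀ i, Integrable (stepPay w σ i) (M.drawLaw i) := fun i =>
    integrable_stepPay (hσ i) (hwi i)
  simp_rw [earnings_eq]
  refine hasSum_integral_of_summable_integral_norm (integrable_byTime_succ_mul hσ hm hφ t) ?_
  set B : ℝ := ∑ i, ∫ x, |stepPay w σ i x| ∂M.drawLaw i with hB
  refine Summable.of_nonneg_of_le (fun n => integral_nonneg fun ω => norm_nonneg _) (fun n => ?_)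
    ((summable_startProb (M := M) (i₀ := i₀) hσ ht).mul_right B)
  calc _ ≤ ∫ ω, byTime t (M.timeAt σ i₀ ω n) *
          M.atStep σ i₀ (fun i x => |stepPay w σ i x|) n ω ∂M.pathLaw :=
        integral_mono_ae (integrable_byTime_succ_mul hσ hm hφ t n).norm
          (integrable_byTime_mul_atStep hσ (fun i => (hm i).abs) (fun i => (hφ i).abs) t n)
          ((norm_byTime_succ_mul_le t).mono fun ω h => h n)
    _ = ∑ i, M.startProb σ i₀ t n i * ∫ x, |stepPay w σ i x| ∂M.drawLaw i :=
        integral_byTime_mul_atStep hσ (fun i => (hm i).abs) (fun i => (hφ i).abs) t n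
    _ ≤ _ := by
        rw [Finset.sum_mul]
        refine Finset.sum_le_sum fun i _ => mul_le_mul_of_nonneg_left ?_ (startProb_nonneg t n i)
        exact Finset.single_le_sum (f := fun i => ∫ x, |stepPay w σ i x| ∂M.drawLaw i)
          (fun i _ => integral_nonneg fun x => abs_nonneg _) (Finset.mem_univ i)

/-- `h` solves the Poisson equation of the policy `σ` with earnings rate `g`: per unit of time in
which the driver is open in state `i`, the earnings, less `g` times the time that passes, plus the
change of `h`, have mean `0`. -/
def IsPoissonSolution (M : Model) (w : Fin 2 → ℝ → ℝ) (σ : Fin 2 → Set ℝ) (g : ℝ)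
    (h : Fin 2 → ℝ) : Prop :=
  ∀ i, M.flow i (σ i) (w i) - g * (1 + M.flow i (σ i) fun τ => τ)
    + (h i.rev - h i) * (M.switchRate i + M.flow i (σ i) (M.switchProb i)) = 0

variable (M σ) in
/-- The increment in one step of the martingale that belongs to a solution of the Poisson
equation. -/
def stepIncrement (w : Fin 2 → ℝ → ℝ) (g : ℝ) (h : Fin 2 → ℝ) (i : Fin 2) (x : Draw) : ℝ :=
  stepPay w σ i x - g * stepTime σ i x + (h (M.stepState σ i x) - h i)

open Classical in
lemma stepState_diff_eq (h : Fin 2 → ℝ) (i : Fin 2) (x : Draw) :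
    h (M.stepState σ i x) - h i
      = (h i.rev - h i) * (if M.stepState σ i x = i then (0 : ℝ) else 1) := by
  by_cases hx : M.stepState σ i x = i
  · rw [if_pos hx, hx]; ring
  · have : M.stepState σ i x = i.rev := by
      revert hx
      generalize M.stepState σ i x = j
      revert i j
      decide
    rw [if_neg hx, this, mul_one]

lemma measurable_stepIncrement (hσ : ∀ i, MeasurableSet (σ i)) (hw : ∀ i, Measurable (w i)) (g : ℝ)
    (h : Fin 2 → ℝ) (i : Fin 2) : Measurable (M.stepIncrement σ w g h i) :=
  ((measurable_stepPay (hσ i) (hw i)).sub ((measurable_stepTime (hσ i)).const_mul g)).add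
    (((measurable_of_countable h).comp (measurable_stepState (hσ i))).sub_const _)

lemma integrable_stepState_comp (hσ : ∀ i, MeasurableSet (σ i)) (h : Fin 2 → ℝ) (i : Fin 2) :
    Integrable (fun x => h (M.stepState σ i x)) (M.drawLaw i) := by
  refine Integrable.of_bound (C := ∑ j, ‖h j‖)
    ((measurable_of_countable h).comp (measurable_stepState (hσ i))).aestronglyMeasurable
    (ae_of_all _ fun x => ?_)
  exact Finset.single_le_sum (f := fun j => ‖h j‖) (fun j _ => norm_nonneg _) (Finset.mem_univ _)

lemma integrable_stepIncrement (hσ : ∀ i, MeasurableSet (σ i)) (hwi : ∀ i, Integrable (w i) (M.F i))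
    (g : ℝ) (h : Fin 2 → ℝ) (i : Fin 2) :
    Integrable (M.stepIncrement σ w g h i) (M.drawLaw i) :=
  ((integrable_stepPay (hσ i) (hwi i)).sub ((integrable_stepTime (hσ i)).const_mul g)).add
    ((integrable_stepState_comp hσ h i).sub (integrable_const _))

lemma integral_stepIncrement (hσ : ∀ i, MeasurableSet (σ i)) (hwi : ∀ i, Integrable (w i) (M.F i))
    {g : ℝ} {h : Fin 2 → ℝ} (hP : IsPoissonSolution M w σ g h) (i : Fin 2) :
    ∫ x, M.stepIncrement σ w g h i x ∂M.drawLaw i = 0 := by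
  have e : ∫ x, (h (M.stepState σ i x) - h i) ∂M.drawLaw i = (h i.rev - h i) *
      ((M.switchRate i + M.flow i (σ i) (M.switchProb i)) / M.clockRate i) := by
    rw [← integral_stepState_ind (hσ i), ← integral_const_mul]
    exact integral_congr_ae (ae_of_all _ fun x => stepState_diff_eq h i x)
  unfold stepIncrement
  rw [integral_add (f := fun x => stepPay w σ i x - g * stepTime σ i x)
      (g := fun x => h (M.stepState σ i x) - h i)
      ((integrable_stepPay (hσ i) (hwi i)).sub ((integrable_stepTime (hσ i)).const_mul g))
      ((integrable_stepState_comp hσ h i).sub (integrable_const _)),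
    integral_sub (integrable_stepPay (hσ i) (hwi i)) ((integrable_stepTime (hσ i)).const_mul g),
    integral_const_mul, integral_stepPay (hσ i), integral_stepTime (hσ i), e]
  have := (M.clockRate_pos i).ne'
  field_simp
  linarith [hP i]

/-- The expected earnings by time `t` are `g t`, up to an error that is sublinear in `t`, as the
last term is small compared to `t` for large `b`. -/
lemma abs_integral_earnings_sub_le (hσ : ∀ i, MeasurableSet (σ i)) (hw : ∀ i, Measurable (w i))
    (hwi : ∀ i, Integrable (w i) (M.F i)) (hK : 0 ≤ K)
    (hwK : ∀ i τ, 0 < τ → |w i τ| ≤ K * (τ + 1)) {g : ℝ} {h : Fin 2 → ℝ}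
    (hP : IsPoissonSolution M w σ g h) {c : ℝ}
    (hc : ∀ t, 0 ≤ t → ∀ N, ∑ n ∈ Finset.range N, ∑ i, M.startProb σ i₀ t n i ≤ c * (t + 1))
    {b : ℝ} (hb : 0 ≤ b) {t : ℝ} (ht : 0 ≤ t) :
    |∫ ω, M.earnings w σ i₀ t ω ∂M.pathLaw - g * t|
      ≤ (|g| + K) * b + (2 * ∑ i, |h i| + K) + (|g| + K) * ((c * (t + 1)) *
        ∑ i, ∫ x, (Ioi b).indicator id (stepTime σ i x) ∂M.drawLaw i) := by
  set H : ℝ := ∑ i, |h i| with hH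
  set ε : ℝ := ∑ i, ∫ x, (Ioi b).indicator id (stepTime σ i x) ∂M.drawLaw i with hε
  set φ : Fin 2 → Draw → ℝ := fun i x => (Ioi b).indicator id (stepTime σ i x) with hφ
  have hφ0 : ∀ i x, 0 ≤ φ i x := fun i x =>
    indicator_nonneg (fun y (hy : b < y) => hb.trans hy.le) _
  have hφm : ∀ i, Measurable (φ i) := fun i =>
    (measurable_id.indicator measurableSet_Ioi).comp (measurable_stepTime (hσ i))
  have hφi : ∀ i, Integrable (φ i) (M.drawLaw i) := fun i =>
    (integrable_stepTime (hσ i)).mono (hφm i).aestronglyMeasurable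
      (ae_of_all _ fun x => norm_indicator_le_norm_self _ _)
  have hpm : ∀ i, Measurable (stepPay w σ i) := fun i => measurable_stepPay (hσ i) (hw i)
  have hpi : ∀ i, Integrable (stepPay w σ i) (M.drawLaw i) := fun i =>
    integrable_stepPay (hσ i) (hwi i)
  have hfm := measurable_stepIncrement (M := M) hσ hw g h
  have hfi := integrable_stepIncrement (M := M) hσ hwi g h
  set p : ℕ → ℝ := fun n => ∑ i, M.startProb σ i₀ t n i with hp
  -- the estimate for finitely many steps
  have hN : ∀ N, |∑ n ∈ Finset.range N, ∫ ω, byTime t (M.timeAt σ i₀ ω (n + 1)) *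
      M.atStep σ i₀ (stepPay w σ) n ω ∂M.pathLaw - g * t|
      ≤ (|g| + K) * b + (2 * H + K) + (|g| + K) * ((c * (t + 1)) * ε) + |g| * (t * p N) := by
    intro N
    have i1 := integrable_finsetSum (Finset.range N) fun n _ =>
      integrable_byTime_succ_mul (M := M) (i₀ := i₀) hσ hpm hpi t n
    have i2 := integrable_sum_byTime_mul_atStep (i₀ := i₀) hσ hfm hfi t N
    have i3 := integrable_sum_byTime_mul_atStep (i₀ := i₀) hσ hφm hφi t N
    have i4 := integrable_byTime_timeAt (M := M) (i₀ := i₀) hσ t N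
    have hzero : ∫ ω, ∑ n ∈ Finset.range N, byTime t (M.timeAt σ i₀ ω n) *
        M.atStep σ i₀ (M.stepIncrement σ w g h) n ω ∂M.pathLaw = 0 := by
      rw [integral_sum_byTime_mul_atStep hσ hfm hfi]
      simp [integral_stepIncrement hσ hwi hP]
    have heq : ∑ n ∈ Finset.range N, ∫ ω, byTime t (M.timeAt σ i₀ ω (n + 1)) *
        M.atStep σ i₀ (stepPay w σ) n ω ∂M.pathLaw - g * t
        = ∫ ω, (∑ n ∈ Finset.range N, byTime t (M.timeAt σ i₀ ω (n + 1)) *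
            M.atStep σ i₀ (stepPay w σ) n ω
          - ∑ n ∈ Finset.range N, byTime t (M.timeAt σ i₀ ω n) *
            M.atStep σ i₀ (M.stepIncrement σ w g h) n ω - g * t) ∂M.pathLaw := by
      have i12 := i1.sub i2
      simp only [Pi.sub_def] at i12
      rw [integral_sub i12 (integrable_const _), integral_sub i1 i2, hzero,
        integral_finsetSum _ fun n _ => integrable_byTime_succ_mul hσ hpm hpi t n]
      simp
    have hlong : ∫ ω, ∑ n ∈ Finset.range N, byTime t (M.timeAt σ i₀ ω n) * M.atStep σ i₀ φ n ω
        ∂M.pathLaw ≤ (c * (t + 1)) * ε := by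
      have hε0 : ∀ i, 0 ≤ ∫ x, φ i x ∂M.drawLaw i := fun i => integral_nonneg (hφ0 i)
      rw [integral_sum_byTime_mul_atStep hσ hφm hφi]
      refine le_trans ?_ (mul_le_mul_of_nonneg_right (hc t ht N)
        (Finset.sum_nonneg fun i _ => hε0 i))
      rw [Finset.sum_mul]
      refine Finset.sum_le_sum fun n _ => ?_
      rw [Finset.sum_mul]
      refine Finset.sum_le_sum fun i _ => mul_le_mul_of_nonneg_left ?_ (startProb_nonneg t n i)
      exact Finset.single_le_sum (f := fun i => ∫ x, φ i x ∂M.drawLaw i) (fun i _ => hε0 i)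
        (Finset.mem_univ i)
    rw [heq]
    calc _ ≤ ∫ ω, ((|g| + K) * (b + ∑ n ∈ Finset.range N, byTime t (M.timeAt σ i₀ ω n) *
            M.atStep σ i₀ φ n ω) + |g| * (t * byTime t (M.timeAt σ i₀ ω N)) + (2 * H + K))
            ∂M.pathLaw := by
          refine (abs_integral_le_integral_abs).trans (integral_mono_ae
            ((i1.sub i2).sub (integrable_const _)).abs
            (((((integrable_const b).add i3).const_mul _).add
              ((i4.const_mul t).const_mul _)).add (integrable_const _)) ?_)
          filter_upwards [stepTime_nonneg_ae (M := M) (σ := σ) (i₀ := i₀), atStep_ae (σ := σ) (i₀ := i₀)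
            fun i => abs_stepPay_le (M := M) (σ := σ) hK (hwK i)] with ω h1 h2
          exact abs_sum_pay_sub_le (S := fun n => M.timeAt σ i₀ ω n)
            (L := fun n => M.atStep σ i₀ (stepTime σ) n ω)
            (pay := fun n => M.atStep σ i₀ (stepPay w σ) n ω)
            (h := fun n => h (M.stateAt σ i₀ ω n)) (timeAt_zero ω) (timeAt_succ ω) h1 ht hb hK h2
            (fun n => Finset.single_le_sum (f := fun i => |h i|) (fun i _ => abs_nonneg _)
              (Finset.mem_univ _)) g N
      _ = (|g| + K) * (b + ∫ ω, ∑ n ∈ Finset.range N, byTime t (M.timeAt σ i₀ ω n) *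
            M.atStep σ i₀ φ n ω ∂M.pathLaw) + |g| * (t * p N) + (2 * H + K) := by
          have j1 := ((integrable_const b).add i3).const_mul (|g| + K)
          have j2 := (i4.const_mul t).const_mul |g|
          have j12 := j1.add j2
          simp only [Pi.add_def] at j1 j12
          rw [integral_add j12 (integrable_const _), integral_add j1 j2, integral_const_mul, integral_const_mul,
            integral_const_mul, integral_add (integrable_const b) i3, integral_byTime_timeAt hσ]
          simp [hp]
      _ ≤ _ := by
          have := mul_le_mul_of_nonneg_left hlong (add_nonneg (abs_nonneg g) hK)
          linarith
  have hp0 : Tendsto p atTop (𝓝 0) :=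
    (summable_startProb (M := M) (i₀ := i₀) hσ ht).tendsto_atTop_zero
  have hl := ((hasSum_integral_earnings (M := M) (i₀ := i₀) hσ hw hwi ht).tendsto_sum_nat.sub_const
    (g * t)).abs
  have hr := ((hp0.const_mul t).const_mul |g|).const_add
    ((|g| + K) * b + (2 * H + K) + (|g| + K) * ((c * (t + 1)) * ε))
  rw [mul_zero, mul_zero, add_zero] at hr
  exact le_of_tendsto_of_tendsto' hl hr hN

/-- The renewal-reward theorem: the earnings rate is the constant of the Poisson equation. -/
theorem reward_eq_of_isPoissonSolution (hσ : ∀ i, MeasurableSet (σ i))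
    (hw : ∀ i, Measurable (w i)) (hwi : ∀ i, Integrable (w i) (M.F i)) (hK : 0 ≤ K)
    (hwK : ∀ i τ, 0 < τ → |w i τ| ≤ K * (τ + 1)) {g : ℝ} {h : Fin 2 → ℝ}
    (hP : IsPoissonSolution M w σ g h) (i₀ : Fin 2) : M.reward w σ i₀ = g := by
  obtain ⟨c, hc0, hc⟩ := exists_sum_startProb_le (M := M) hσ
  have hε : Tendsto (fun b : ℝ => (|g| + K) * (c * 2 *
      ∑ i, ∫ x, (Ioi b).indicator id (stepTime σ i x) ∂M.drawLaw i)) atTop (𝓝 0) := by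
    have := ((tendsto_finsetSum Finset.univ fun i _ =>
      tendsto_integral_long_step (M := M) hσ i).const_mul (c * 2)).const_mul (|g| + K)
    simpa using this
  refine Tendsto.liminf_eq (Metric.tendsto_atTop.2 fun δ hδ => ?_)
  obtain ⟨b, hb1, hb0⟩ := ((hε.eventually (gt_mem_nhds (half_pos hδ))).and
    (eventually_ge_atTop 0)).exists
  set ε := ∑ i, ∫ x, (Ioi b).indicator id (stepTime σ i x) ∂M.drawLaw i with hεdef
  have hε0 : 0 ≤ ε := Finset.sum_nonneg fun i _ => integral_nonneg fun x =>
    indicator_nonneg (fun y (hy : b < y) => hb0.trans hy.le) _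
  set A := (|g| + K) * b + (2 * ∑ i, |h i| + K) with hA
  refine ⟨max 1 (2 * (|A| + 1) / δ), fun t ht => ?_⟩
  have ht1 : 1 ≤ t := (le_max_left _ _).trans ht
  have ht0 : 0 < t := by linarith
  have hAt : 2 * (|A| + 1) ≤ t * δ := (div_le_iff₀ hδ).1 ((le_max_right _ _).trans ht)
  have hmain := abs_integral_earnings_sub_le hσ hw hwi hK hwK hP (hc i₀) hb0 ht0.le
  rw [← hεdef, ← hA] at hmain
  have h2 : (|g| + K) * ((c * (t + 1)) * ε) ≤ t * ((|g| + K) * (c * 2 * ε)) := by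
    have : 0 ≤ (|g| + K) * (c * ε) := by positivity
    nlinarith
  have h3 : t * ((|g| + K) * (c * 2 * ε)) < t * (δ / 2) := mul_lt_mul_of_pos_left hb1 ht0
  rw [Real.dist_eq, div_sub' ht0.ne', abs_div, abs_of_pos ht0, div_lt_iff₀ ht0, mul_comm t g]
  have := le_abs_self A
  linarith

end Reward

/-! ### The flow of accepted trips -/

section Flow

variable {i : Fin 2} {s S : Set ℝ} {v : ℝ → ℝ}

lemma integrable_gain (x y : ℝ) : Integrable (fun τ => x * τ + y * M.switchProb i τ) (M.F i) :=
  ((M.F_mean i).const_mul x).add (integrable_switchProb.const_mul y)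

lemma flow_gain (s : Set ℝ) (x y : ℝ) : M.flow i s (fun τ => x * τ + y * M.switchProb i τ)
    = x * M.flow i s (fun τ => τ) + y * M.flow i s (M.switchProb i) := by
  rw [flow, integral_add ((M.F_mean i).const_mul x).integrableOn
    (integrable_switchProb.const_mul y).integrableOn, integral_const_mul, integral_const_mul,
    flow, flow]
  ring

lemma flow_nonneg (hs : MeasurableSet s) (hs0 : s ⊆ Ioi 0) (hv : ∀ τ, 0 < τ → 0 ≤ v τ) :
    0 ≤ M.flow i s v :=
  mul_nonneg (M.arrival_pos i).le (setIntegral_nonneg hs fun τ h => hv τ (hs0 h))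

lemma flow_pos (hv : ∀ τ, 0 < τ → 0 < v τ) (hvi : Integrable v (M.F i)) :
    0 < M.flow i (Ioi 0) v := by
  refine mul_pos (M.arrival_pos i) ?_
  rw [setIntegral_pos_iff_support_of_nonneg_ae
    ((ae_restrict_mem measurableSet_Ioi).mono fun τ h => (hv τ h).le) hvi.integrableOn]
  have h : Function.support v ∩ Ioi 0 = Ioi 0 :=
    inter_eq_right.2 fun τ h => (hv τ h).ne'
  have h1 : M.F i (Ioi 0) = 1 :=
    (mem_ae_iff_prob_eq_one measurableSet_Ioi).1 (M.ae_pos i)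
  rw [h, h1]
  exact one_pos

lemma indicator_le_of_mem_iff (hS : ∀ τ, 0 < τ → (τ ∈ S ↔ 0 < v τ)) {τ : ℝ}
    (hτ : 0 < τ) : s.indicator v τ ≤ S.indicator v τ := by
  by_cases h1 : τ ∈ S
  · rw [indicator_of_mem h1]
    exact indicator_le_self' (fun _ _ => ((hS τ hτ).1 h1).le) τ
  · rw [indicator_of_notMem h1]
    by_cases h2 : τ ∈ s
    · rw [indicator_of_mem h2]
      exact not_lt.1 fun h => h1 ((hS τ hτ).2 h)
    · rw [indicator_of_notMem h2]

/-- Accepting exactly the requests of positive value maximizes the flow of value. -/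
lemma flow_le_flow (hs : MeasurableSet s) (hSm : MeasurableSet S)
    (hS : ∀ τ, 0 < τ → (τ ∈ S ↔ 0 < v τ)) (hv : Integrable v (M.F i)) :
    M.flow i s v ≤ M.flow i S v := by
  refine mul_le_mul_of_nonneg_left ?_ (M.arrival_pos i).le
  rw [← integral_indicator hs, ← integral_indicator hSm]
  exact integral_mono_ae (hv.indicator hs) (hv.indicator hSm)
    ((M.ae_pos i).mono fun τ hτ => indicator_le_of_mem_iff hS hτ)

lemma ae_eq_of_flow_eq (hs : MeasurableSet s) (hSm : MeasurableSet S)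
    (hS : ∀ τ, 0 < τ → (τ ∈ S ↔ 0 < v τ)) (hv : Integrable v (M.F i))
    (hne : ∀ᵐ τ ∂M.F i, v τ ≠ 0) (h : M.flow i s v = M.flow i S v) : s =ᵐ[M.F i] S := by
  have h1 : ∫ τ, s.indicator v τ ∂M.F i = ∫ τ, S.indicator v τ ∂M.F i := by
    rw [integral_indicator hs, integral_indicator hSm]
    exact mul_left_cancel₀ (M.arrival_pos i).ne' h
  have h2 := (integral_eq_iff_of_ae_le (hv.indicator hs) (hv.indicator hSm)
    ((M.ae_pos i).mono fun τ hτ => indicator_le_of_mem_iff hS hτ)).1 h1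
  filter_upwards [h2, hne] with τ h3 h4
  refine propext (show τ ∈ s ↔ τ ∈ S from ?_)
  by_cases h5 : τ ∈ s <;> by_cases h6 : τ ∈ S <;> simp_all

lemma flow_eq_flow_posPart (hSm : MeasurableSet S) (hS : ∀ τ, 0 < τ → (τ ∈ S ↔ 0 < v τ)) :
    M.flow i S v = M.flow i (Ioi 0) fun τ => max (v τ) 0 := by
  rw [flow, flow, ← integral_indicator hSm, ← integral_indicator measurableSet_Ioi]
  congr 1
  refine integral_congr_ae ?_
  filter_upwards [M.ae_pos i] with τ hτ
  rw [indicator_of_mem (mem_Ioi.2 hτ)]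
  by_cases h : τ ∈ S
  · rw [indicator_of_mem h, max_eq_left ((hS τ hτ).1 h).le]
  · rw [indicator_of_notMem h, max_eq_right (not_lt.1 fun h' => h ((hS τ hτ).2 h'))]

lemma continuous_flow_posPart {u v : ℝ → ℝ} (hu : Integrable u (M.F i))
    (hv : Integrable v (M.F i)) :
    Continuous fun θ : ℝ => M.flow i (Ioi 0) fun τ => max (u τ + θ * v τ) 0 := by
  have hint : ∀ θ : ℝ, Integrable (fun τ => max (u τ + θ * v τ) 0) (M.F i) := fun θ =>
    (hu.add (hv.const_mul θ)).pos_part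
  refine Continuous.mul continuous_const (LipschitzWith.continuous
    (K := NNReal.mk (∫ τ in Ioi 0, |v τ| ∂M.F i) (integral_nonneg fun τ => abs_nonneg _))
    (LipschitzWith.of_dist_le_mul fun θ θ' => ?_))
  rw [Real.dist_eq, Real.dist_eq, ← integral_sub (hint θ).integrableOn (hint θ').integrableOn]
  refine abs_integral_le_integral_abs.trans ?_
  rw [NNReal.coe_mk, mul_comm, ← integral_const_mul]
  refine integral_mono ((hint θ).sub (hint θ')).abs.integrableOn (hv.abs.const_mul _).integrableOn
    fun τ => ?_
  refine (abs_max_sub_max_le_abs _ _ _).trans_eq ?_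
  rw [← abs_mul]
  congr 1
  ring

end Flow

/-! ### The earnings rate of a policy, and a criterion for optimality -/

section Verification

variable {i : Fin 2} {s : Set ℝ} {m z : Fin 2 → ℝ}

lemma integrable_price (i : Fin 2) : Integrable (M.price m z i) (M.F i) := integrable_gain _ _

lemma measurable_price (i : Fin 2) : Measurable (M.price m z i) := by
  have : Continuous (M.price m z i) := by unfold price; fun_prop
  exact this.measurable

lemma flow_price (i : Fin 2) (s : Set ℝ) : M.flow i s (M.price m z i)
    = m i * M.flow i s (fun τ => τ) + z i * M.flow i s (M.switchProb i) := flow_gain _ _ _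

lemma abs_price_le (i : Fin 2) {τ : ℝ} (hτ : 0 < τ) :
    |M.price m z i τ| ≤ (∑ j, (|m j| + |z j|)) * (τ + 1) := by
  have h1 : |m i| + |z i| ≤ ∑ j, (|m j| + |z j|) :=
    Finset.single_le_sum (f := fun j => |m j| + |z j|) (fun j _ => by positivity)
      (Finset.mem_univ i)
  have hq := M.switchProb_nonneg i hτ.le
  calc |M.price m z i τ| ≤ |m i * τ| + |z i * M.switchProb i τ| := abs_add_le _ _
    _ = |m i| * τ + |z i| * M.switchProb i τ := by
        rw [abs_mul, abs_mul, abs_of_pos hτ, abs_of_nonneg hq]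
    _ ≤ (|m i| + |z i|) * (τ + 1) := by
        nlinarith [abs_nonneg (m i), abs_nonneg (z i), M.switchProb_le_one i τ]
    _ ≤ _ := by gcongr

lemma switchRate_add_flow_pos (hs : MeasurableSet s) (hs0 : s ⊆ Ioi 0) :
    0 < M.switchRate i + M.flow i s (M.switchProb i) :=
  add_pos_of_pos_of_nonneg (M.switchRate_pos i)
    (flow_nonneg hs hs0 fun _ h => M.switchProb_nonneg i h.le)

lemma one_add_flow_pos (hs : MeasurableSet s) (hs0 : s ⊆ Ioi 0) :
    0 < 1 + M.flow i s (fun τ => τ) :=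
  add_pos_of_pos_of_nonneg one_pos (flow_nonneg hs hs0 fun _ h => h.le)

/-- The earnings rate is the average of the earnings over the average of the time, where state `i` is
weighted by the rate at which the other state is left. -/
lemma reward_price (hσ : IsPolicy σ) (i₀ : Fin 2) : M.reward (M.price m z) σ i₀ =
    ((M.switchRate 1 + M.flow 1 (σ 1) (M.switchProb 1)) * M.flow 0 (σ 0) (M.price m z 0)
      + (M.switchRate 0 + M.flow 0 (σ 0) (M.switchProb 0)) * M.flow 1 (σ 1) (M.price m z 1))
    / ((M.switchRate 1 + M.flow 1 (σ 1) (M.switchProb 1)) * (1 + M.flow 0 (σ 0) fun τ => τ)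
      + (M.switchRate 0 + M.flow 0 (σ 0) (M.switchProb 0)) * (1 + M.flow 1 (σ 1) fun τ => τ)) := by
  have hm : ∀ i, MeasurableSet (σ i) := fun i => (hσ i).1.measurableSet
  have hQ0 := switchRate_add_flow_pos (M := M) (i := 0) (hm 0) (hσ 0).2
  have hQ1 := switchRate_add_flow_pos (M := M) (i := 1) (hm 1) (hσ 1).2
  have hT0 := one_add_flow_pos (M := M) (i := 0) (hm 0) (hσ 0).2
  have hT1 := one_add_flow_pos (M := M) (i := 1) (hm 1) (hσ 1).2
  set Q0 := M.switchRate 0 + M.flow 0 (σ 0) (M.switchProb 0)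
  set Q1 := M.switchRate 1 + M.flow 1 (σ 1) (M.switchProb 1)
  set T0 := 1 + M.flow 0 (σ 0) fun τ => τ with hT0d
  set T1 := 1 + M.flow 1 (σ 1) fun τ => τ with hT1d
  set W0 := M.flow 0 (σ 0) (M.price m z 0)
  set W1 := M.flow 1 (σ 1) (M.price m z 1)
  have hD : 0 < Q1 * T0 + Q0 * T1 := by positivity
  set g := (Q1 * W0 + Q0 * W1) / (Q1 * T0 + Q0 * T1) with hg
  have hg' : g * (Q1 * T0 + Q0 * T1) = Q1 * W0 + Q0 * W1 := div_mul_cancel₀ _ hD.ne'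
  refine reward_eq_of_isPoissonSolution hm measurable_price integrable_price
    (Finset.sum_nonneg fun j _ => by positivity) (fun i τ hτ => abs_price_le i hτ)
    (h := ![0, (g * T0 - W0) / Q0]) (fun i => ?_) i₀
  fin_cases i
  · change W0 - g * T0 + ((g * T0 - W0) / Q0 - 0) * Q0 = 0
    field_simp
    ring
  · change W1 - g * T1 + (0 - (g * T0 - W0) / Q0) * Q1 = 0
    field_simp
    linarith

/-- The value of a trip in state `i` to a driver who earns at rate `g` otherwise and for whom ending
the trip in the other state is worth `e i`. -/
def tripGain (M : Model) (m z : Fin 2 → ℝ) (g : ℝ) (e : Fin 2 → ℝ) (i : Fin 2) (τ : ℝ) : ℝ :=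
  (m i - g) * τ + (z i + e i) * M.switchProb i τ

lemma flow_tripGain (g : ℝ) (e : Fin 2 → ℝ) (i : Fin 2) (s : Set ℝ) :
    M.flow i s (M.tripGain m z g e i) = M.flow i s (M.price m z i)
      - g * M.flow i s (fun τ => τ) + e i * M.flow i s (M.switchProb i) := by
  unfold tripGain
  rw [flow_gain, flow_price]
  ring

/-- The optimality criterion: if accepting exactly the trips of positive value `tripGain` balances
the cost `g - e i * switchRate i` of waiting in each state, then this policy is optimal, and it is
the only one if no trip has value `0`. -/
lemma isUniqueOptimal_of_tripGain {g : ℝ} {e : Fin 2 → ℝ} (he : e 1 = -e 0) (hσ : IsPolicy σ)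
    (hpos : ∀ i τ, 0 < τ → (τ ∈ σ i ↔ 0 < M.tripGain m z g e i τ))
    (hne : ∀ i, ∀ᵐ τ ∂M.F i, M.tripGain m z g e i τ ≠ 0)
    (hval : ∀ i, M.flow i (σ i) (M.tripGain m z g e i) = g - e i * M.switchRate i) (i₀ : Fin 2) :
    M.IsUniqueOptimal (M.price m z) i₀ σ := by
  have hm : ∀ {σ}, IsPolicy σ → ∀ i, MeasurableSet (σ i) := fun h i => (h i).1.measurableSet
  have hint : ∀ i, Integrable (M.tripGain m z g e i) (M.F i) := fun i => integrable_gain _ _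
  have hle : ∀ σ', IsPolicy σ' → ∀ i,
      M.flow i (σ' i) (M.tripGain m z g e i) ≤ M.flow i (σ i) (M.tripGain m z g e i) :=
    fun σ' h' i => flow_le_flow (hm h' i) (hm hσ i) (hpos i) (hint i)
  -- The earnings rate falls short of `g` by the weighted shortfalls of the two states.
  have key : ∀ σ', IsPolicy σ' → ∃ a b D : ℝ, 0 < a ∧ 0 < b ∧ 0 < D ∧
      M.reward (M.price m z) σ' i₀ = g -
      (a * (M.flow 0 (σ 0) (M.tripGain m z g e 0) - M.flow 0 (σ' 0) (M.tripGain m z g e 0))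
        + b * (M.flow 1 (σ 1) (M.tripGain m z g e 1) - M.flow 1 (σ' 1) (M.tripGain m z g e 1)))
        / D := by
    intro σ' h'
    have hQ0 := switchRate_add_flow_pos (M := M) (i := 0) (hm h' 0) (h' 0).2
    have hQ1 := switchRate_add_flow_pos (M := M) (i := 1) (hm h' 1) (h' 1).2
    have hT0 := one_add_flow_pos (M := M) (i := 0) (hm h' 0) (h' 0).2
    have hT1 := one_add_flow_pos (M := M) (i := 1) (hm h' 1) (h' 1).2
    have hD := add_pos (mul_pos hQ1 hT0) (mul_pos hQ0 hT1)
    refine ⟨_, _, _, hQ1, hQ0, hD, ?_⟩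
    rw [reward_price h', hval 0, hval 1, flow_tripGain, flow_tripGain, he, eq_sub_iff_add_eq,
      ← add_div, div_eq_iff hD.ne']
    ring
  have hopt : M.reward (M.price m z) σ i₀ = g := by
    obtain ⟨a, b, D, -, -, -, h⟩ := key σ hσ
    rw [h, sub_self, sub_self]
    simp
  refine ⟨⟨hσ, fun σ' h' => ?_⟩, fun σ' h' => ?_⟩
  · obtain ⟨a, b, D, ha, hb, hD, h⟩ := key σ' h'
    rw [hopt, h]
    have h0 := mul_nonneg ha.le (sub_nonneg.2 (hle σ' h' 0))
    have h1 := mul_nonneg hb.le (sub_nonneg.2 (hle σ' h' 1))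
    exact sub_le_self _ (div_nonneg (add_nonneg h0 h1) hD.le)
  · obtain ⟨a, b, D, ha, hb, hD, h⟩ := key σ' h'.1
    have hge := h'.2 σ hσ
    rw [hopt, h, le_sub_self_iff, div_le_iff₀ hD, zero_mul] at hge
    have h0 := mul_nonneg ha.le (sub_nonneg.2 (hle σ' h'.1 0))
    have h1 := mul_nonneg hb.le (sub_nonneg.2 (hle σ' h'.1 1))
    have e0 : M.flow 0 (σ' 0) (M.tripGain m z g e 0) = M.flow 0 (σ 0) (M.tripGain m z g e 0) := by
      have := (mul_eq_zero.1 (le_antisymm (by linarith) h0)).resolve_left ha.ne'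
      linarith
    have e1 : M.flow 1 (σ' 1) (M.tripGain m z g e 1) = M.flow 1 (σ 1) (M.tripGain m z g e 1) := by
      have := (mul_eq_zero.1 (le_antisymm (by linarith) h1)).resolve_left hb.ne'
      linarith
    intro i
    refine ae_eq_of_flow_eq (hm h'.1 i) (hm hσ i) (hpos i) (hint i) (hne i) ?_
    fin_cases i
    · exact e0
    · exact e1

end Verification

/-! ### The choice of the prices -/

section Choice

variable {m z : Fin 2 → ℝ}

/-- `λ_i E[τ]`: the time spent on trips, if all trips are accepted, per unit of time in which the
driver is open in state `i`. -/
def busyFlow (M : Model) (i : Fin 2) : ℝ := M.flow i (Ioi 0) fun τ => τ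

/-- `λ_i E[q_{i → j}]`: the rate of trips at whose end the state of the world is the other one, if
all trips are accepted, while the driver is open in state `i`. -/
def crossFlow (M : Model) (i : Fin 2) : ℝ := M.flow i (Ioi 0) (M.switchProb i)

lemma busyFlow_pos (i : Fin 2) : 0 < M.busyFlow i := flow_pos (fun _ h => h) (M.F_mean i)

lemma crossFlow_pos (i : Fin 2) : 0 < M.crossFlow i :=
  flow_pos (fun _ h => M.switchProb_pos i h) integrable_switchProb

lemma crossFlow_lt (i : Fin 2) : M.crossFlow i < M.switchRate i * M.busyFlow i := by
  have h := flow_pos (M := M) (i := i) (v := fun τ => M.switchRate i * τ + -1 * M.switchProb i τ)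
    (fun τ hτ => by linarith [M.switchProb_lt i hτ]) (integrable_gain _ _)
  rw [flow_gain] at h
  unfold busyFlow crossFlow
  linarith

lemma measureReal_Ioi (i : Fin 2) : (M.F i).real (Ioi 0) = 1 := by
  rw [measureReal_def, (mem_ae_iff_prob_eq_one measurableSet_Ioi).1 (M.ae_pos i),
    ENNReal.toReal_one]

lemma stateRate_eq (w : Fin 2 → ℝ → ℝ) (i : Fin 2) {s : Set ℝ} (hs : (M.F i).real s ≠ 0) :
    M.stateRate w i s = M.flow i s (w i) / (1 + M.flow i s fun τ => τ) := by
  have hl := (M.arrival_pos i).ne'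
  have h1 : M.meanPay w i s = M.flow i s (w i) / (M.arrival i * (M.F i).real s) := by
    unfold meanPay flow; field_simp
  have h2 : M.meanTime i s
      = (1 + M.flow i s fun τ => τ) / (M.arrival i * (M.F i).real s) := by
    unfold meanTime flow; field_simp
  rw [stateRate, h1, h2, div_div_div_cancel_right₀ (mul_ne_zero hl hs)]

lemma stateRate_of_null (w : Fin 2 → ℝ → ℝ) (i : Fin 2) {s : Set ℝ} (hs : (M.F i).real s = 0) :
    M.stateRate w i s = 0 := by
  simp [stateRate, meanPay, hs]

lemma stateRate_price_Ioi (i : Fin 2) : M.stateRate (M.price m z) i (Ioi 0)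
    = (m i * M.busyFlow i + z i * M.crossFlow i) / (1 + M.busyFlow i) := by
  rw [stateRate_eq _ _ (by rw [measureReal_Ioi]; exact one_ne_zero), flow_price]
  rfl

lemma Tfull_eq (i : Fin 2) : M.Tfull i = 1 + M.busyFlow i := by
  have hl := (M.arrival_pos i).ne'
  rw [Tfull, meanTime, measureReal_Ioi, busyFlow, flow]
  field_simp

lemma Qfull_eq (i : Fin 2) : M.Qfull i = M.switchRate i + M.crossFlow i := rfl

lemma isOpen_upTo (t : ℝ≥0∞) : IsOpen (upTo t) :=
  isOpen_Ioi.inter (isOpen_Iio.preimage ENNReal.continuous_ofReal)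

lemma upTo_top : upTo ⊤ = Ioi 0 := by ext τ; simp [upTo]

/-- Let `g` be the optimal earnings rate and `d` the advantage of being open in state `1`, and let the
prices be `m = (x + g, m₁)` and `z = (y - d, d)`, where `m₁` is such that state `1` meets its target.
They have the required properties if state `0` meets its target as well and if the value
`x τ + y q_{0 → 1}(τ)` of the accepted trips balances the cost of waiting in state `0`. -/
lemma exists_price_of_gain {R₁ R₂ d g x y : ℝ} (hR₂ : 0 < R₂) (hd : 0 < d) (hg : 0 ≤ g)
    (hgR : g = R₂ - d * (M.Qfull 1 / M.Tfull 1))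
    (htarget : x * M.busyFlow 0 + y * M.crossFlow 0
      = R₁ * M.Tfull 0 - g * M.busyFlow 0 + d * M.crossFlow 0)
    (hx : 0 ≤ x + g) (hy : 0 < y) {t : ℝ≥0∞}
    (ht : upTo t = {τ | 0 < τ ∧ 0 < x * τ + y * M.switchProb 0 τ})
    (hval : M.flow 0 (upTo t) (fun τ => x * τ + y * M.switchProb 0 τ) = g - d * M.switchRate 0) :
    ∃ m z : Fin 2 → ℝ, 0 ≤ m 0 ∧ 0 ≤ m 1 ∧ 0 ≤ z 1 ∧
      M.MeetsTargets (M.price m z) R₁ R₂ ∧ M.IsSurge (M.price m z) ∧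
      ∀ i₀, M.IsUniqueOptimal (M.price m z) i₀ ![upTo t, Ioi 0] := by
  have hA0 := M.busyFlow_pos 0
  have hA1 := M.busyFlow_pos 1
  have hB1 := M.crossFlow_pos 1
  have hμ1 := M.switchRate_pos 1
  have hμ0 := M.switchRate_pos 0
  have hT0 : 0 < 1 + M.busyFlow 0 := by linarith
  have hT1 : 0 < 1 + M.busyFlow 1 := by linarith
  rw [Tfull_eq, Qfull_eq] at hgR
  rw [Tfull_eq] at htarget
  have hgR' : g * (1 + M.busyFlow 1)
      = R₂ * (1 + M.busyFlow 1) - d * (M.switchRate 1 + M.crossFlow 1) := by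
    rw [hgR]; field_simp
  have hgR2 : g < R₂ := by
    rw [hgR]
    have : 0 < d * ((M.switchRate 1 + M.crossFlow 1) / (1 + M.busyFlow 1)) := by positivity
    linarith
  -- the multiplier of state `1` that meets the target `R₂`. A trip is then worth `(m₁ - g) τ`.
  set m₁ := (R₂ * (1 + M.busyFlow 1) - d * M.crossFlow 1) / M.busyFlow 1 with hm₁
  have hm₁A : m₁ * M.busyFlow 1 = R₂ * (1 + M.busyFlow 1) - d * M.crossFlow 1 :=
    div_mul_cancel₀ _ hA1.ne'
  have hbal : (m₁ - g) * M.busyFlow 1 = g + d * M.switchRate 1 := by linarith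
  have hm₁g : 0 < m₁ - g := by
    have : 0 < (m₁ - g) * M.busyFlow 1 := by rw [hbal]; positivity
    exact pos_of_mul_pos_left this hA1.le
  refine ⟨![x + g, m₁], ![y - d, d], hx, by change 0 ≤ m₁; linarith, hd.le, ⟨?_, ?_⟩,
    ⟨Ioi 0, isOpen_Ioi, subset_rfl, fun s hs hs0 => ?_⟩, fun i₀ => ?_⟩
  · rw [stateRate_price_Ioi, div_eq_iff hT0.ne']
    change (x + g) * M.busyFlow 0 + (y - d) * M.crossFlow 0 = _
    linarith
  · rw [stateRate_price_Ioi, div_eq_iff hT1.ne']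
    change m₁ * M.busyFlow 1 + d * M.crossFlow 1 = _
    linarith
  · have hrate1 : M.stateRate (M.price ![x + g, m₁] ![y - d, d]) 1 (Ioi 0) = R₂ := by
      rw [stateRate_price_Ioi, div_eq_iff hT1.ne']
      change m₁ * M.busyFlow 1 + d * M.crossFlow 1 = _
      linarith
    rw [hrate1]
    by_cases h0 : (M.F 0).real s = 0
    · rw [stateRate_of_null _ _ h0]; exact hR₂
    have hsm := hs.measurableSet
    have hT := one_add_flow_pos (M := M) (i := 0) hsm hs0
    have hB : 0 ≤ M.flow 0 s (M.switchProb 0) :=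
      flow_nonneg hsm hs0 fun _ h => M.switchProb_nonneg 0 h.le
    have hle := flow_le_flow (M := M) (i := 0) (s := s) (S := upTo t)
      (v := fun τ => x * τ + y * M.switchProb 0 τ) hsm (isOpen_upTo t).measurableSet
      (fun τ hτ => by rw [ht]; exact ⟨fun h => h.2, fun h => ⟨hτ, h⟩⟩) (integrable_gain _ _)
    rw [hval, flow_gain] at hle
    rw [stateRate_eq _ _ h0, div_lt_iff₀ hT, flow_price]
    change (x + g) * _ + (y - d) * _ < _
    have h1 : 0 ≤ d * M.flow 0 s (M.switchProb 0) := mul_nonneg hd.le hB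
    have h2 : 0 < d * M.switchRate 0 := mul_pos hd hμ0
    have h3 := mul_lt_mul_of_pos_right hgR2 hT
    linarith
  · have e0 : M.tripGain ![x + g, m₁] ![y - d, d] g ![d, -d] 0
        = fun τ => x * τ + y * M.switchProb 0 τ := by
      ext τ
      change (x + g - g) * τ + (y - d + d) * M.switchProb 0 τ = _
      ring
    have e1 : M.tripGain ![x + g, m₁] ![y - d, d] g ![d, -d] 1
        = fun τ => (m₁ - g) * τ + 0 * M.switchProb 1 τ := by
      ext τ
      change (m₁ - g) * τ + (d + -d) * M.switchProb 1 τ = _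
      ring
    refine isUniqueOptimal_of_tripGain (g := g) (e := ![d, -d]) rfl
      (Fin.forall_fin_two.2 ⟨⟨isOpen_upTo t, fun τ h => h.1⟩, isOpen_Ioi, subset_rfl⟩)
      (Fin.forall_fin_two.2 ⟨fun τ hτ => ?_, fun τ hτ => ?_⟩)
      (Fin.forall_fin_two.2 ⟨?_, ?_⟩) (Fin.forall_fin_two.2 ⟨?_, ?_⟩) i₀
    · rw [e0]
      change τ ∈ upTo t ↔ _
      rw [ht]
      exact ⟨fun h => h.2, fun h => ⟨hτ, h⟩⟩
    · rw [e1]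
      have : 0 < (m₁ - g) * τ := mul_pos hm₁g hτ
      exact ⟨fun _ => by linarith, fun _ => hτ⟩
    · rw [e0]
      exact M.ae_gain_ne_zero 0 hy
    · rw [e1]
      filter_upwards [M.ae_pos 1] with τ hτ
      have : 0 < (m₁ - g) * τ := mul_pos hm₁g hτ
      linarith
    · rw [e0]
      exact hval
    · rw [e1, flow_gain]
      change (m₁ - g) * M.busyFlow 1 + 0 * _ = g - -d * M.switchRate 1
      linarith

/-- If the targets are close enough, then trips in state `0` can be priced by their effect on the
state of the world alone, on top of the earnings rate, and every trip is worth accepting. -/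
lemma exists_price_of_ratio {R₁ R₂ : ℝ} (hR₁ : 0 ≤ R₁) (hR : R₁ < R₂)
    (hcase : (R₂ - R₁) * M.Tfull 0 * (M.Qfull 1 / M.Tfull 1 + M.switchRate 0)
      < R₂ * (M.Qfull 1 / M.Tfull 1 * M.Tfull 0 + M.Qfull 0)) :
    ∃ m z : Fin 2 → ℝ, 0 ≤ m 0 ∧ 0 ≤ m 1 ∧ 0 ≤ z 1 ∧
      M.MeetsTargets (M.price m z) R₁ R₂ ∧ M.IsSurge (M.price m z) ∧
      ∀ i₀, M.IsUniqueOptimal (M.price m z) i₀ ![Ioi 0, Ioi 0] := by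
  have hA0 := M.busyFlow_pos 0
  have hA1 := M.busyFlow_pos 1
  have hB0 := M.crossFlow_pos 0
  have hB1 := M.crossFlow_pos 1
  have hμ0 := M.switchRate_pos 0
  have hμ1 := M.switchRate_pos 1
  have hT0 : 0 < M.Tfull 0 := by rw [Tfull_eq]; linarith
  have hQ0 : 0 < M.Qfull 0 := by rw [Qfull_eq]; linarith
  have hκ : 0 < M.Qfull 1 / M.Tfull 1 := by
    rw [Tfull_eq, Qfull_eq]; exact div_pos (by linarith) (by linarith)
  set κ := M.Qfull 1 / M.Tfull 1 with hκd
  have hE : 0 < κ * M.Tfull 0 + M.Qfull 0 := by positivity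
  set d := (R₂ - R₁) * M.Tfull 0 / (κ * M.Tfull 0 + M.Qfull 0) with hd
  have hd0 : 0 < d := div_pos (mul_pos (sub_pos.2 hR) hT0) hE
  have hdE : d * (κ * M.Tfull 0 + M.Qfull 0) = (R₂ - R₁) * M.Tfull 0 := div_mul_cancel₀ _ hE.ne'
  have hG : d * (κ + M.switchRate 0) < R₂ := by
    rw [hd, div_mul_eq_mul_div, div_lt_iff₀ hE]; exact hcase
  set G := R₂ - d * κ - d * M.switchRate 0 with hGd
  have hG0 : 0 < G := by rw [hGd]; linarith
  have hdμ : 0 < d * M.switchRate 0 := mul_pos hd0 hμ0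
  have hy0 : 0 < G / M.crossFlow 0 := div_pos hG0 hB0
  have hyB : G / M.crossFlow 0 * M.crossFlow 0 = G := div_mul_cancel₀ _ hB0.ne'
  have h := exists_price_of_gain (R₁ := R₁) (R₂ := R₂) (d := d) (g := R₂ - d * κ) (x := 0)
    (y := G / M.crossFlow 0) (t := ⊤) (by linarith) hd0 (by linarith) rfl ?_ (by linarith) hy0 ?_ ?_
  · rwa [upTo_top] at h
  · rw [hyB, hGd]
    rw [Qfull_eq] at hdE
    have := M.Tfull_eq 0
    have hb : M.busyFlow 0 = M.Tfull 0 - 1 := by linarith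
    rw [hb]
    linarith
  · rw [upTo_top]
    ext τ
    refine ⟨fun h => ⟨h, ?_⟩, fun h => h.1⟩
    have := mul_pos hy0 (M.switchProb_pos 0 h)
    linarith
  · rw [upTo_top, flow_gain]
    change 0 * _ + _ * M.crossFlow 0 = _
    rw [hyB, hGd]
    ring

/-- If the targets are far apart, then a threshold in state `0` that meets the balance condition is
found by continuity, along a segment in the space of the parameters `(d, y)`. At its start the
accepted trips are worth too little, and at its end waiting in state `0` has no cost. -/
lemma exists_price_of_not_ratio {R₁ R₂ : ℝ} (hR₁ : 0 ≤ R₁) (hR : R₁ < R₂)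
    (hcase : R₂ * (M.Qfull 1 / M.Tfull 1 * M.Tfull 0 + M.Qfull 0)
      ≤ (R₂ - R₁) * M.Tfull 0 * (M.Qfull 1 / M.Tfull 1 + M.switchRate 0)) :
    ∃ m z : Fin 2 → ℝ, 0 ≤ m 0 ∧ 0 ≤ m 1 ∧ 0 ≤ z 1 ∧
      M.MeetsTargets (M.price m z) R₁ R₂ ∧ M.IsSurge (M.price m z) ∧
      ∃ t : ℝ≥0∞, (0 < R₁ → 0 < t) ∧
        ∀ i₀, M.IsUniqueOptimal (M.price m z) i₀ ![upTo t, Ioi 0] := by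
  have hA0 := M.busyFlow_pos 0
  have hA1 := M.busyFlow_pos 1
  have hB0 := M.crossFlow_pos 0
  have hB1 := M.crossFlow_pos 1
  have hμ0 := M.switchRate_pos 0
  have hμ1 := M.switchRate_pos 1
  have hR₂ : 0 < R₂ := by linarith
  have hT0 : 0 < M.Tfull 0 := by rw [Tfull_eq]; linarith
  have hTA : M.busyFlow 0 = M.Tfull 0 - 1 := by rw [Tfull_eq]; ring
  have hQ0 : 0 < M.Qfull 0 := by rw [Qfull_eq]; linarith
  have hQB : M.Qfull 0 = M.switchRate 0 + M.crossFlow 0 := rfl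
  have hκ : 0 < M.Qfull 1 / M.Tfull 1 := by
    rw [Tfull_eq, Qfull_eq]; exact div_pos (by linarith) (by linarith)
  set κ := M.Qfull 1 / M.Tfull 1 with hκd
  set A := M.busyFlow 0
  set B := M.crossFlow 0
  set T := M.Tfull 0
  set μ := M.switchRate 0
  have hκμ : 0 < κ + μ := by linarith
  -- the largest advantage of state `1` for which waiting in state `0` has a nonnegative cost
  set D := R₂ / (κ + μ) with hD
  have hD0 : 0 < D := div_pos hR₂ hκμ
  have hDκ : D * (κ + μ) = R₂ := div_mul_cancel₀ _ hκμ.ne'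
  set c := R₁ * T / B with hc
  have hc0 : 0 ≤ c := by positivity
  have hcB : c * B = R₁ * T := div_mul_cancel₀ _ hB0.ne'
  -- `x`, as a function of `d` and `y`, is determined by the target `R₁`
  set X : ℝ → ℝ → ℝ := fun d y => (R₁ * T - (R₂ - d * κ) * A + d * B - y * B) / A with hX
  have hXA : ∀ d y, X d y * A = R₁ * T - (R₂ - d * κ) * A + d * B - y * B := fun d y =>
    div_mul_cancel₀ _ hA0.ne'
  set P : ℝ → ℝ → ℝ := fun x y =>
    M.flow 0 (Ioi 0) fun τ => max (x * τ + y * M.switchProb 0 τ) 0 with hP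
  set f : ℝ → ℝ := fun θ => P (X (D * (1 + θ) / 2) (θ * (D + c))) (θ * (D + c))
    - R₂ * (1 - θ) / 2 with hf
  have hcont : Continuous f := by
    obtain ⟨x₀, x₁, hx⟩ : ∃ x₀ x₁, ∀ θ, X (D * (1 + θ) / 2) (θ * (D + c)) = x₀ + θ * x₁ :=
      ⟨(R₁ * T - (R₂ - D / 2 * κ) * A + D / 2 * B) / A,
        (D / 2 * κ * A + D / 2 * B - (D + c) * B) / A, fun θ => by rw [hX]; ring⟩
    have hfun : f = fun θ => (M.flow 0 (Ioi 0) fun τ => max ((fun τ => x₀ * τ) τ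
        + θ * (fun τ => x₁ * τ + (D + c) * M.switchProb 0 τ) τ) 0) - R₂ * (1 - θ) / 2 := by
      ext θ
      simp only [hf, hP, hx]
      congr 3
      ext τ
      congr 1
      ring
    rw [hfun]
    exact (continuous_flow_posPart ((M.F_mean 0).const_mul x₀) (integrable_gain _ _)).sub
      (by fun_prop)
  have hf0 : f 0 < 0 := by
    have h1 : P (X (D * (1 + 0) / 2) (0 * (D + c))) (0 * (D + c))
        = max (X (D / 2) 0) 0 * A := by
      simp only [hP, add_zero, mul_one, zero_mul]
      rw [mul_comm]
      have : M.flow 0 (Ioi 0) (fun τ => max (X (D / 2) 0 * τ) 0)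
          = M.flow 0 (Ioi 0) (fun τ => max (X (D / 2) 0) 0 * τ) := by
        unfold flow
        congr 1
        refine setIntegral_congr_fun measurableSet_Ioi fun τ (hτ : 0 < τ) => ?_
        rw [max_mul_of_nonneg _ _ hτ.le, zero_mul]
      rw [this, flow, integral_const_mul]
      change _ = M.flow 0 (Ioi 0) _ * _
      unfold flow
      ring
    have h2 : X (D / 2) 0 * A < R₂ / 2 := by
      rw [hXA]
      have : D * (κ * T + M.Qfull 0) ≤ (R₂ - R₁) * T := by
        rw [hD, div_mul_eq_mul_div, div_le_iff₀ hκμ]; exact hcase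
      have h3 : 0 < D * (κ * T + M.Qfull 0) := by positivity
      have h4 : R₁ * T - (R₂ - D / 2 * κ) * A + D / 2 * B - 0 * B - R₂ / 2
          = (R₁ - R₂) * T + D / 2 * (κ * T + M.Qfull 0) := by
        rw [hQB, hTA, ← hDκ]; ring
      linarith
    have h3 : max (X (D / 2) 0) 0 * A < R₂ / 2 := by
      rw [max_mul_of_nonneg _ _ hA0.le, zero_mul]
      exact max_lt h2 (by linarith)
    change P _ _ - R₂ * (1 - 0) / 2 < 0
    rw [h1]
    linarith
  have hP0 : ∀ x y, 0 ≤ P x y := fun x y =>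
    flow_nonneg measurableSet_Ioi subset_rfl fun _ _ => le_max_right _ _
  have hf1 : 0 ≤ f 1 := by
    have := hP0 (X (D * (1 + 1) / 2) (1 * (D + c))) (1 * (D + c))
    change 0 ≤ P _ _ - R₂ * (1 - 1) / 2
    linarith
  obtain ⟨θ, ⟨hθ0, hθ1⟩, hθ⟩ := intermediate_value_Icc zero_le_one hcont.continuousOn
    ⟨hf0.le, hf1⟩
  have hθpos : 0 < θ := by
    refine hθ0.lt_of_ne fun h => ?_
    rw [← h] at hθ
    linarith
  set d := D * (1 + θ) / 2 with hd
  set y := θ * (D + c) with hy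
  set x := X d y with hx
  have hd0 : 0 < d := by positivity
  have hy0 : 0 < y := by positivity
  have hval : P x y = R₂ * (1 - θ) / 2 := by
    change P x y - R₂ * (1 - θ) / 2 = 0 at hθ
    linarith
  have hG : R₂ - d * κ - d * μ = R₂ * (1 - θ) / 2 := by rw [hd, ← hDκ]; ring
  have hG0 : 0 ≤ R₂ * (1 - θ) / 2 := by
    have : 0 ≤ 1 - θ := by linarith
    positivity
  have hdμ : 0 < d * μ := mul_pos hd0 hμ0
  have htarget : x * A + y * B = R₁ * T - (R₂ - d * κ) * A + d * B := by
    have := hXA d y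
    linarith
  -- `m 0` is nonnegative since `y ≤ d + c` on the whole segment
  have hm₀ : 0 ≤ x + (R₂ - d * κ) := by
    have e : (x + (R₂ - d * κ)) * A = (c + d - y) * B := by linarith
    have e2 : 0 ≤ c + d - y := by
      have : c + d - y = (1 - θ) * (D / 2 + c) := by rw [hd, hy]; ring
      rw [this]
      exact mul_nonneg (by linarith) (by positivity)
    have : 0 ≤ (x + (R₂ - d * κ)) * A := by rw [e]; positivity
    exact nonneg_of_mul_nonneg_left this hA0
  obtain ⟨t, ht, htpos⟩ := exists_upTo (M := M) (i := 0) (x := x) hy0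
  have hbal : M.flow 0 (upTo t) (fun τ => x * τ + y * M.switchProb 0 τ) = R₂ - d * κ - d * μ := by
    rw [flow_eq_flow_posPart (isOpen_upTo t).measurableSet fun τ hτ => by
      rw [ht]; exact ⟨fun h => h.2, fun h => ⟨hτ, h⟩⟩]
    exact hval.trans hG.symm
  obtain ⟨m, z, h1, h2, h3, h4, h5, h6⟩ := exists_price_of_gain (M := M) (R₁ := R₁) (R₂ := R₂)
    (d := d) (g := R₂ - d * κ) (x := x) (y := y) hR₂ hd0 (by linarith) rfl htarget hm₀ hy0 ht
    hbal
  refine ⟨m, z, h1, h2, h3, h4, h5, t, fun hR₁pos => htpos ?_, h6⟩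
  -- If no trip were worth accepting, then waiting would have no cost, which happens only at the end
  -- of the segment. There `m 0 = 0`, so short trips are worth accepting if `R₁ > 0`.
  by_contra hneg
  have hPz : P x y = 0 := by
    have : M.flow 0 (Ioi 0) (fun τ => max (x * τ + y * M.switchProb 0 τ) 0)
        = M.flow 0 (Ioi 0) (fun _ => 0) := by
      unfold flow
      congr 1
      refine setIntegral_congr_fun measurableSet_Ioi fun τ (hτ : 0 < τ) => max_eq_right ?_
      have e1 := mul_lt_mul_of_pos_left (M.switchProb_lt 0 hτ) hy0
      have e2 := mul_nonpos_of_nonpos_of_nonneg (not_lt.1 hneg) hτ.le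
      linarith
    simp only [hP, this]
    simp [flow]
  have hθ1' : θ = 1 := by
    rw [hPz] at hval
    have : R₂ * (1 - θ) = 0 := by linarith
    linarith [(mul_eq_zero.1 this).resolve_left hR₂.ne']
  have hdD : d = D := by rw [hd, hθ1']; ring
  have hyD : y = D + c := by rw [hy, hθ1', one_mul]
  have hxg : x = -(D * μ) := by
    have e := hXA d y
    rw [← hx, hdD, hyD, ← hDκ] at e
    have : (x + D * μ) * A = 0 := by linarith
    linarith [(mul_eq_zero.1 this).resolve_right hA0.ne']
  have hcpos : 0 < c := by positivity
  apply hneg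
  rw [hxg, hyD]
  have := mul_pos hcpos hμ0
  change 0 < -(D * μ) + (D + c) * μ
  linarith

end Choice

/-! ### The ratio bound -/

/-- The bound lies in `[0, 1)`, and targets with a ratio above it satisfy the hypothesis of
`exists_price_of_ratio`, which is the weaker condition `1 - R₁ / R₂ < D / (T₀ (Q₁ + μ T₁))`. Here
`Tᵢ` and `Qᵢ` belong to state `i` of `Fin 2`, `μ` is the switching rate of state `0`, and
`D = Q₁ T₀ + Q₀ T₁`. -/
lemma ratioBound_mem : M.ratioBound ∈ Ico (0 : ℝ) 1 ∧ ∀ R₁ R₂ : ℝ, 0 < R₂ →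
    M.ratioBound < R₁ / R₂ →
    (R₂ - R₁) * M.Tfull 0 * (M.Qfull 1 / M.Tfull 1 + M.switchRate 0)
      < R₂ * (M.Qfull 1 / M.Tfull 1 * M.Tfull 0 + M.Qfull 0) := by
  have hA0 := M.busyFlow_pos 0
  have hA1 := M.busyFlow_pos 1
  have hB0 := M.crossFlow_pos 0
  have hB1 := M.crossFlow_pos 1
  have hμ := M.switchRate_pos 0
  have hμ1 := M.switchRate_pos 1
  have hT0 : 0 < M.Tfull 0 := by rw [Tfull_eq]; linarith
  have hT1 : 0 < M.Tfull 1 := by rw [Tfull_eq]; linarith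
  have hQ0 : 0 < M.Qfull 0 := by rw [Qfull_eq]; linarith
  have hQ1 : 0 < M.Qfull 1 := by rw [Qfull_eq]; linarith
  have hQT : 0 < M.switchRate 0 * M.Tfull 0 - M.Qfull 0 := by
    rw [Tfull_eq, Qfull_eq]; linarith [M.crossFlow_lt 0]
  rw [ratioBound]
  set T0 := M.Tfull 0
  set T1 := M.Tfull 1
  set Q0 := M.Qfull 0
  set Q1 := M.Qfull 1
  set μ := M.switchRate 0
  set δ := μ * T0 - Q0 with hδ
  have hN : Q1 * δ + Q0 * (T1 * μ + Q1) = μ * (Q1 * T0 + Q0 * T1) := by rw [hδ]; ring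
  rw [hN, div_mul_div_comm, one_mul]
  have hden : 0 < T0 * (Q1 * δ + μ * (T1 * μ + Q1)) := by positivity
  have hnum : 0 < μ * (Q1 * T0 + Q0 * T1) := by positivity
  refine ⟨⟨?_, by linarith [div_pos hnum hden]⟩, fun R₁ R₂ hR₂ h => ?_⟩
  · rw [sub_nonneg, div_le_one hden]
    have e : T0 * (Q1 * δ + μ * (T1 * μ + Q1)) - μ * (Q1 * T0 + Q0 * T1)
        = T0 * Q1 * δ + μ * T1 * δ := by rw [hδ]; ring
    have : 0 ≤ T0 * Q1 * δ + μ * T1 * δ := by positivity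
    linarith
  · rw [lt_div_iff₀ hR₂] at h
    -- dropping the term `Q1 * δ` from the denominator weakens the bound
    have hden' : 0 < T0 * (μ * (T1 * μ + Q1)) := by positivity
    have h1 : μ * (Q1 * T0 + Q0 * T1) / (T0 * (Q1 * δ + μ * (T1 * μ + Q1)))
        ≤ μ * (Q1 * T0 + Q0 * T1) / (T0 * (μ * (T1 * μ + Q1))) := by
      refine div_le_div_of_nonneg_left hnum.le hden' ?_
      have : 0 ≤ Q1 * δ := by positivity
      exact mul_le_mul_of_nonneg_left (by linarith) hT0.le
    have h2 := mul_le_mul_of_nonneg_right h1 hR₂.le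
    have h3 : R₂ - R₁ < μ * (Q1 * T0 + Q0 * T1) / (T0 * (μ * (T1 * μ + Q1))) * R₂ := by linarith
    have h4 := mul_lt_mul_of_pos_right h3 (show 0 < T0 * (Q1 / T1 + μ) by positivity)
    calc (R₂ - R₁) * T0 * (Q1 / T1 + μ) = (R₂ - R₁) * (T0 * (Q1 / T1 + μ)) := by ring
      _ < _ := h4
      _ = _ := by field_simp; ring

end Model
end SurgePricing

end

theorem mainTheorem1 (M : SurgePricing.Model) (R₁ R₂ : ℝ) (hR₁ : 0 ≤ R₁) (hR : R₁ < R₂) :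
    (∃ m z : Fin 2 → ℝ, 0 ≤ m 0 ∧ 0 ≤ m 1 ∧ 0 ≤ z 1 ∧
      M.MeetsTargets (M.price m z) R₁ R₂ ∧ M.IsSurge (M.price m z) ∧
      ∃ t : ℝ≥0∞, (0 < R₁ → 0 < t) ∧
        ∀ i₀, M.IsUniqueOptimal (M.price m z) i₀ ![SurgePricing.Model.upTo t, Ioi 0]) ∧
    M.ratioBound ∈ Ico (0 : ℝ) 1 ∧
    (R₁ / R₂ ∈ Ioo M.ratioBound 1 →
      ∃ m z : Fin 2 → ℝ, 0 ≤ m 0 ∧ 0 ≤ m 1 ∧ 0 ≤ z 1 ∧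
        M.MeetsTargets (M.price m z) R₁ R₂ ∧ M.IsSurge (M.price m z) ∧
        ∀ i₀, M.IsUniqueOptimal (M.price m z) i₀ ![Ioi 0, Ioi 0]) := by
  refine ⟨?_, SurgePricing.Model.ratioBound_mem.1, fun h => ?_⟩
  · by_cases hcase : (R₂ - R₁) * M.Tfull 0 * (M.Qfull 1 / M.Tfull 1 + M.switchRate 0)
        < R₂ * (M.Qfull 1 / M.Tfull 1 * M.Tfull 0 + M.Qfull 0)
    · obtain ⟨m, z, h1, h2, h3, h4, h5, h6⟩ := SurgePricing.Model.exists_price_of_ratio hR₁ hR hcase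
      refine ⟨m, z, h1, h2, h3, h4, h5, ⊤, fun _ => ENNReal.zero_lt_top, ?_⟩
      rwa [SurgePricing.Model.upTo_top]
    · exact SurgePricing.Model.exists_price_of_not_ratio hR₁ hR (not_lt.1 hcase)
  · have hcase := SurgePricing.Model.ratioBound_mem.2 R₁ R₂ (hR₁.trans_lt hR) h.1
    exact SurgePricing.Model.exists_price_of_ratio hR₁ hR hcase
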